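/- Let $\varepsilon,\eta\in(0,1/3]$. Let $G=(V,E)$ be a finite simple graph with $n$ nodes and maximum degree $\Delta$, in which every node $v$ has a list $\Psi(v)$ of exactly $\Delta+1$ colors (from a finite color space of any size), and let $V=V_{sparse}\cup C_1\cup\dots\cup C_k$ be an $(\varepsilon,\eta)$-almost-clique decomposition of $G$. That is, this is a partition of $V$ such that: no $v\in V_{sparse}$ is $\eta$-dense, where $v$ is $\eta$-dense if at least $(1-\eta)\Delta$ neighbors $u$ of $v$ satisfy $|N(u)\cap N(v)|\ge(1-\eta)\Delta$; $(1-\varepsilon)\Delta\le|C_i|\le(1+\varepsilon)\Delta$ for every $i$; and $|N(v)\cap C_i|\ge(1-\varepsilon)\Delta$ for every $i$ and $v\in C_i$. For $w\in C_i$, let $e(w)=|N(w)\cap\bigcup_{j\ne i}C_j|$ be its external degree and $a(w)=|C_i\setminus N(w)|$ its antidegree. SlackGeneration, started with no node colored, is the following procedure. Every node independently joins a random set $S$ with probability $1/20$. Every node $v\in S$ independently picks a uniformly random color $c_v\in\Psi(v)$, and is permanently colored with $c_v$ if no neighbor $u\in S$ of $v$ has $c_u=c_v$; all other nodes stay uncolored.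 The slack of a node $v$ afterwards is the number of colors in $\Psi(v)$ that no neighbor of $v$ is colored with, minus the number of uncolored neighbors of $v$. There is a constant $c_1>0$, depending only on $\varepsilon,\eta$, and for every $K\ge1$ there is a constant $c>0$, depending only on $\varepsilon,\eta,K$, such that for all $G$, $\Psi$ and decompositions as above, with probability at least $1-n^{-K}$ the following both hold after SlackGeneration: 1. if $\Delta\ge c\log n$, then every node $v\in V_{sparse}$ has slack at least $c_1\Delta$; 2. every node $w\in C_i$ (for any $i$) with $a(w)+e(w)\ge c\log n$ has slack at least $c_1\,(e(w)+a(w))$. -/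

import Mathlib

open MeasureTheory ProbabilityTheory

namespace ListColoring

section Decomposition

variable {V : Type*} [Fintype V] [DecidableEq V] (G : SimpleGraph V) [DecidableRel G.Adj]

/-- Two nodes are `ε`-similar if they have at least `(1 - ε)Δ` common neighbors. -/
def IsSimilar (ε : ℝ) (u v : V) : Prop :=
  (1 - ε) * (G.maxDegree : ℝ) ≤ ((G.neighborFinset v ∩ G.neighborFinset u).card : ℝ)

/-- Two nodes are `ε`-friends if they are `ε`-similar and adjacent. -/
def IsFriend (ε : ℝ) (u v : V) : Prop :=
  IsSimilar G ε u v ∧ G.Adj u v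

open Classical in
/-- A node is `ε`-dense if it has at least `(1 - ε)Δ` `ε`-friends. -/
def IsDense (ε : ℝ) (u : V) : Prop :=
  (1 - ε) * (G.maxDegree : ℝ) ≤ ((Finset.univ.filter fun v => IsFriend G ε u v).card : ℝ)

/-- The partition `V = Vsparse ∪ C 0 ∪ ... ∪ C (k - 1)` is an
`(ε, η)`-almost-clique decomposition of `G`. -/
structure IsACD (ε η : ℝ) (Vsparse : Finset V) {k : ℕ} (C : Fin k → Finset V) : Prop where
  disjoint_sparse : ∀ i, Disjoint Vsparse (C i)
  disjoint_cliques : ∀ i j, i ≠ j → Disjoint (C i) (C j)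
  cover : ∀ v, v ∈ Vsparse ∨ ∃ i, v ∈ C i
  sparse_not_dense : ∀ v ∈ Vsparse, ¬ IsDense G η v
  le_card : ∀ i, (1 - ε) * (G.maxDegree : ℝ) ≤ ((C i).card : ℝ)
  card_le : ∀ i, ((C i).card : ℝ) ≤ (1 + ε) * (G.maxDegree : ℝ)
  le_card_neighbors : ∀ i, ∀ v ∈ C i,
    (1 - ε) * (G.maxDegree : ℝ) ≤ ((G.neighborFinset v ∩ C i).card : ℝ)

/-- The external degree `e(v) = |N(v) ∩ ⋃_{j ≠ i} C_j|` of a node `v ∈ C i`. -/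
def externalDegree {k : ℕ} (C : Fin k → Finset V) (i : Fin k) (v : V) : ℕ :=
  (G.neighborFinset v ∩ (Finset.univ.filter fun j => j ≠ i).biUnion C).card

/-- The antidegree `a(v) = |C_i \ N(v)|` of a node `v ∈ C i`. -/
def antidegree {k : ℕ} (C : Fin k → Finset V) (i : Fin k) (v : V) : ℕ :=
  (C i \ G.neighborFinset v).card

end Decomposition

section Coloring

variable {V : Type*} [Fintype V] [DecidableEq V] (G : SimpleGraph V) [DecidableRel G.Adj]
variable {U : ℕ}

/-- The palette of `v` in a partially colored graph: the colors of the list `Ψ v` that have not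
been permanently taken by a neighbor of `v`. Colors are the elements of `Fin U`; a partial coloring
`col` maps an uncolored node to `none`. -/
def palette (Ψ : V → Finset (Fin U)) (col : V → Option (Fin U)) (v : V) : Finset (Fin U) :=
  (Ψ v).filter fun c => ∀ u ∈ G.neighborFinset v, col u ≠ some c

/-- The number of uncolored neighbors of `v`. -/
def uncoloredDegree (col : V → Option (Fin U)) (v : V) : ℕ :=
  ((G.neighborFinset v).filter fun u => col u = none).card

/-- The slack of `v`: the size of its palette minus the number of its uncolored neighbors. -/
def slack (Ψ : V → Finset (Fin U)) (col : V → Option (Fin U)) (v : V) : ℤ :=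
  ((palette G Ψ col v).card : ℤ) - (uncoloredDegree G col v : ℤ)

/-- All nodes of `S` try their candidate color in the induced subgraph `G[S]`: a node of `S`
is permanently colored with its candidate color if no neighbor in `S` has the same candidate. -/
def tryColors (S : Finset V) (cand : V → Fin U) (v : V) : Option (Fin U) :=
  if v ∈ S ∧ ∀ u ∈ S, G.Adj v u → cand u ≠ cand v then some (cand v) else none

/-- The random choices of one node with list `L`: an independent pair consisting of a coin that is
`true` (the node joins the sample) with probability `1/20`, and a uniformly random color of `L`. -/
noncomputable def nodeLaw (L : Finset (Fin U)) (hL : L.Nonempty) : Measure (Bool × Fin U) :=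
  (bernoulliMeasure true false (⟨1 / 20, by norm_num, by norm_num⟩ : unitInterval)).prod
    (PMF.uniformOfFinset L hL).toMeasure

/-- The joint law of the random choices of all nodes, which are independent. -/
noncomputable def choiceLaw (Ψ : V → Finset (Fin U)) (hΨ : ∀ v, (Ψ v).Nonempty) :
    Measure (V → Bool × Fin U) :=
  Measure.pi fun v => nodeLaw (Ψ v) (hΨ v)

/-- Slack generation, started with no node colored: the partial coloring produced by one random
color trial in `G[S]`, where `S` is the random sample. The color of a node outside `S` is unused. -/
def slackGeneration (ω : V → Bool × Fin U) : V → Option (Fin U) :=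
  tryColors G (Finset.univ.filter fun v => (ω v).1 = true) fun v => (ω v).2

end Coloring

/-- Lists of size `Δ + 1` are nonempty. -/
theorem lists_nonempty {V : Type*} [Fintype V] (G : SimpleGraph V) [DecidableRel G.Adj] {U : ℕ}
    {Ψ : V → Finset (Fin U)} (hΨ : ∀ v, (Ψ v).card = G.maxDegree + 1) (v : V) : (Ψ v).Nonempty :=
  Finset.card_pos.mp (by rw [hΨ v]; exact Nat.succ_pos _)

end ListColoring

/-!
Slack generation gives slack to sparse nodes and to nodes of almost-cliques with large external
degree or antidegree.

Let `Δ` be the maximum degree, `v` a node, and let `z` be `Δ` if `v` is sparse and the sum of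
antidegree and external degree otherwise. Since the list of `v` has `Δ + 1` colors, the slack of
`v` is at least `Δ + 1 - deg v` plus the number of colors `c` that are taken by two neighbors of
`v`, or by one neighbor if `c` is not on the list of `v` (`le_slack`).

*Graph structure.* Either `Δ + 1 - deg v` is of order `z`, and there is nothing to prove, or the
neighborhood of `v` contains of order `z Δ` pairs of nonadjacent nodes. For sparse nodes this is
immediate from the definition (`nonedges_of_not_isDense`). For a node `w` of an almost-clique
(`IsACD.degree_le_or_nonedges`), external neighbors have few neighbors in the almost-clique of `w`,
and the nodes of the almost-clique that are not adjacent to `w` send many edges into the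
neighborhood of `w`, which are missing inside, the degrees being at most `Δ`. The latter fails only
if more than half of the almost-clique is not adjacent to `w`; then `w` would have many sparse
neighbors, and one of them would be dense if few pairs were nonadjacent
(`exists_isDense_of_card_nonedges_lt`).

*Probability.* A witness for the color `c` is a pair of nonadjacent neighbors of `v` with `c` on
their lists, if `c` is on the list of `v`, and otherwise a single neighbor with `c` on its list. If
in the neighborhoods of `v` and of the witness exactly the nodes of the witness try `c`, then they
keep `c`, and `c` counts towards the slack of `v`. Whether this happens depends only on the set of
nodes that try `c`. These sets are revealed one color at a time. Given the sets revealed so far, the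
remaining nodes join the next one independently of each other, with nearly the original
probabilities, so the conditional probability that the color counts is at least a constant times the
total weight of the witnesses that avoid the nodes used so far. This gives an exponential
supermartingale (`prodExp_exp_le_one`). The total weight of the witnesses is at least of order
`z` (`card_nonedges_le_sum_witnesses`), and the part of it that meets the sample is a sum of
independent contributions, which exceeds half of the total only with probability exponentially
small in `z`. So the slack of `v` is below a constant times `z` with probability at most
`2 exp (-κ z / 10000)` (`choiceLaw_slack_lt_le`), and a union bound over the nodes with
`z ≥ c log n` finishes the proof.
-/

namespace ListColoring

/-! ### Product weights -/

section ProductWeights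

variable {V α β : Type*} [Fintype V] [DecidableEq V] [Fintype α] [Fintype β]

/-- The expectation of `F` when every node `u` independently draws an element of `α`, the element
`a` having weight `w u a`. The weights need not be normalized. -/
noncomputable def prodExp (w : V → α → ℝ) (F : (V → α) → ℝ) : ℝ :=
  ∑ x : V → α, (∏ u, w u (x u)) * F x

theorem prodExp_le_prodExp {w : V → α → ℝ} (hw : ∀ u a, 0 ≤ w u a) {F F' : (V → α) → ℝ}
    (h : ∀ x, (∀ u, w u (x u) ≠ 0) → F x ≤ F' x) : prodExp w F ≤ prodExp w F' := by
  refine Finset.sum_le_sum fun x _ => ?_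
  by_cases hx : ∀ u, w u (x u) ≠ 0
  · exact mul_le_mul_of_nonneg_left (h x hx) (Finset.prod_nonneg fun u _ => hw u _)
  · push Not at hx
    obtain ⟨u, hu⟩ := hx
    rw [Finset.prod_eq_zero (Finset.mem_univ u) hu, zero_mul, zero_mul]

theorem prodExp_prod (w f : V → α → ℝ) :
    prodExp w (fun x => ∏ u, f u (x u)) = ∏ u, ∑ a, w u a * f u a := by
  classical
  simp only [prodExp, ← Finset.prod_mul_distrib]
  rw [Finset.prod_univ_sum, Fintype.piFinset_univ]

theorem prodExp_one {w : V → α → ℝ} (hw : ∀ u, ∑ a, w u a = 1) : prodExp w (fun _ => 1) = 1 := by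
  simpa [hw] using prodExp_prod w fun _ _ => 1

theorem prodExp_add (w : V → α → ℝ) (F F' : (V → α) → ℝ) :
    prodExp w (fun x => F x + F' x) = prodExp w F + prodExp w F' := by
  simp only [prodExp, mul_add, Finset.sum_add_distrib]

theorem prodExp_const_mul (w : V → α → ℝ) (r : ℝ) (F : (V → α) → ℝ) :
    prodExp w (fun x => r * F x) = r * prodExp w F := by
  simp only [prodExp, Finset.mul_sum]
  exact Finset.sum_congr rfl fun x _ => by ring

theorem prodExp_sum {ι : Type*} (s : Finset ι) (w : V → α → ℝ) (F : ι → (V → α) → ℝ) :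
    prodExp w (fun x => ∑ i ∈ s, F i x) = ∑ i ∈ s, prodExp w (F i) := by
  simp only [prodExp, Finset.mul_sum]
  exact Finset.sum_comm

/-- The image of a product law under a map that acts on every node separately is the product of
the image laws. -/
theorem prodExp_map [DecidableEq β] (w : V → α → ℝ) (φ : α → β) (F : (V → β) → ℝ) :
    prodExp w (fun x => F fun u => φ (x u)) =
      prodExp (fun u b => ∑ a with φ a = b, w u a) F := by
  classical
  simp only [prodExp, Finset.prod_univ_sum, Finset.sum_mul]
  rw [← Finset.sum_fiberwise (s := Finset.univ) (g := fun (x : V → α) u => φ (x u))]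
  refine Finset.sum_congr rfl fun y _ => ?_
  have : (Finset.univ.filter fun x : V → α => (fun u => φ (x u)) = y) =
      Fintype.piFinset fun u => Finset.univ.filter fun a => φ a = y u := by
    ext x; simp [funext_iff]
  rw [this]
  refine Finset.sum_congr rfl fun x hx => ?_
  have : (fun u => φ (x u)) = y := by
    ext u
    simpa using Fintype.mem_piFinset.1 hx u
  rw [this]

theorem prodExp_prodMk (w : V → α → ℝ) (b : V → β → ℝ) (F : (V → α × β) → ℝ) :
    prodExp (fun u p => w u p.1 * b u p.2) F =
      prodExp w fun x => prodExp b fun y => F fun u => (x u, y u) := by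
  classical
  simp only [prodExp, Finset.mul_sum]
  rw [← Fintype.sum_prod_type',
    ← (Equiv.arrowProdEquivProdArrow V (fun _ => α) fun _ => β).symm.sum_comp]
  refine Finset.sum_congr rfl fun x _ => ?_
  simp only [Equiv.arrowProdEquivProdArrow, Equiv.coe_fn_symm_mk, Finset.prod_mul_distrib]
  ring

end ProductWeights

/-! ### Revealing a random coloring color by color -/

section Reveal

variable {V C : Type*} [Fintype C] [DecidableEq C]

/-- The weights of the trial of a node `u` restricted to the colors of `D`: each color of
`D ∩ Ψ u` has weight `q`, and the rest of the mass is on `none`. -/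
noncomputable def trialWeight (Ψ : V → Finset C) (q : ℝ) (D : Finset C) (u : V) : Option C → ℝ
  | none => 1 - q * ((D ∩ Ψ u).card : ℝ)
  | some c => if c ∈ D ∩ Ψ u then q else 0

/-- The weights of a coin that shows `true` with probability `h u`. -/
def coinWeight (h : V → ℝ) (u : V) : Bool → ℝ
  | true => h u
  | false => 1 - h u

theorem sum_trialWeight (Ψ : V → Finset C) (q : ℝ) (D : Finset C) (u : V) :
    ∑ o, trialWeight Ψ q D u o = 1 := by
  rw [Fintype.sum_option]
  simp only [trialWeight]
  rw [Finset.sum_ite_mem, Finset.univ_inter, Finset.sum_const, nsmul_eq_mul]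
  ring

theorem sum_coinWeight (h : V → ℝ) (u : V) : ∑ b, coinWeight h u b = 1 := by
  simp [coinWeight]

/-- The result of a trial on `D` followed, for the nodes that are still idle, by a coin flip that
decides whether they draw `c`. -/
def revealNext (c : C) : Option C × Bool → Option C
  | (none, true) => some c
  | (o, _) => o

theorem trialWeight_insert {Ψ : V → Finset C} {q : ℝ} {D : Finset C} {c : C} (hc : c ∉ D)
    {h : V → ℝ} (hh : ∀ u, (1 - q * ((D ∩ Ψ u).card : ℝ)) * h u = if c ∈ Ψ u then q else 0) :
    trialWeight Ψ q (insert c D) = fun u o =>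
      ∑ p with revealNext c p = o, trialWeight Ψ q D u p.1 * coinWeight h u p.2 := by
  funext u o
  rw [Finset.sum_filter, Fintype.sum_prod_type, Fintype.sum_option]
  have key := hh u
  rcases o with _ | d
  · simp only [revealNext, Fintype.sum_bool, trialWeight, coinWeight]
    simp only [reduceCtorEq, if_false, if_true, Finset.sum_const_zero, add_zero, zero_add]
    rw [mul_sub, key]
    by_cases hcu : c ∈ Ψ u
    · rw [Finset.insert_inter_of_mem hcu, Finset.card_insert_of_notMem (by simp [hc]), if_pos hcu]
      push_cast; ring
    · rw [Finset.insert_inter_of_notMem hcu, if_neg hcu]; ring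
  · simp only [revealNext, Fintype.sum_bool, trialWeight, coinWeight]
    simp only [Option.some.injEq, reduceCtorEq, if_false, add_zero]
    have : ∀ x : C, ((if x = d then (if x ∈ D ∩ Ψ u then q else 0) * h u else 0) +
        if x = d then (if x ∈ D ∩ Ψ u then q else 0) * (1 - h u) else 0) =
        if x = d then (if x ∈ D ∩ Ψ u then q else 0) else 0 := by
      intro x; split_ifs <;> ring
    simp only [this, key, Finset.sum_ite_eq', Finset.mem_univ, if_true]
    by_cases hcd : c = d
    · subst hcd; simp [hc]
    · simp [hcd, Ne.symm hcd]

variable [Fintype V] [DecidableEq V]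

/-- The nodes that drew nothing. -/
def idle (σ : V → Option C) : Finset V := Finset.univ.filter fun u => σ u = none

/-- The nodes that drew the color `c`. -/
def colorClass (σ : V → Option C) (c : C) : Finset V := Finset.univ.filter fun u => σ u = some c

/-- Exponential lower-tail estimate for the number of colors whose class has a property `Q c`.
The color classes are revealed one after another. Given the classes revealed so far, the idle
nodes join the next class independently, with probabilities between `q` and `20 q / 19`; so if
`ρ c R` bounds the probability of `Q c` from below when `R` is the set of idle nodes, the
partial products of `exp ((1 - e⁻¹) ρ c R - 1_{Q c})` form a supermartingale. As `ρ c` is monotone,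
it may be evaluated at the final set of idle nodes. -/
theorem prodExp_exp_le_one {Ψ : V → Finset C} {q : ℝ} (hq : 0 ≤ q)
    (hΨ : ∀ u, q * ((Ψ u).card : ℝ) ≤ 1 / 20)
    (Q : C → Finset V → Prop) [∀ c, DecidablePred (Q c)] (ρ : C → Finset V → ℝ)
    (hmono : ∀ c, Monotone (ρ c))
    (hρ : ∀ c R (h : V → ℝ), (∀ u, c ∈ Ψ u → q ≤ h u) → (∀ u, 0 ≤ h u) →
      (∀ u, h u ≤ 20 / 19 * q) → (∀ u, h u ≤ 1) →
      ρ c R ≤ prodExp (coinWeight h) fun β =>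
        if Q c (R.filter fun u => β u = true) then 1 else 0) (D : Finset C) :
    prodExp (trialWeight Ψ q D) (fun σ => Real.exp (∑ c ∈ D,
      ((1 - Real.exp (-1)) * ρ c (idle σ) - if Q c (colorClass σ c) then 1 else 0))) ≤ 1 := by
  induction D using Finset.induction_on with
  | empty => simpa using (prodExp_one (sum_trialWeight Ψ q ∅)).le
  | insert c D hc ih =>
    have hcard : ∀ u, q * ((D ∩ Ψ u).card : ℝ) ≤ 1 / 20 := fun u =>
      (mul_le_mul_of_nonneg_left (by exact_mod_cast Finset.card_le_card Finset.inter_subset_right)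
        hq).trans (hΨ u)
    have hpos : ∀ u, 0 < 1 - q * ((D ∩ Ψ u).card : ℝ) := fun u => by linarith [hcard u]
    have hnn : ∀ u o, 0 ≤ trialWeight Ψ q D u o := by
      rintro u (_ | d)
      · exact (hpos u).le
      · simp only [trialWeight]; split_ifs <;> simp [hq]
    -- The probability that a node draws `c`, given that it drew no color of `D`.
    set h : V → ℝ := fun u => if c ∈ Ψ u then q / (1 - q * ((D ∩ Ψ u).card : ℝ)) else 0 with hh
    have hmul : ∀ u, (1 - q * ((D ∩ Ψ u).card : ℝ)) * h u = if c ∈ Ψ u then q else 0 := by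
      intro u
      simp only [hh]
      split_ifs
      · field_simp [(hpos u).ne']
      · ring
    have h0 : ∀ u, 0 ≤ h u := by
      intro u; simp only [hh]; split_ifs
      · exact div_nonneg hq (hpos u).le
      · exact le_rfl
    have hlow : ∀ u, c ∈ Ψ u → q ≤ h u := by
      intro u hu
      simp only [hh, if_pos hu]
      rw [le_div_iff₀ (hpos u)]
      have : 0 ≤ q * ((D ∩ Ψ u).card : ℝ) := by positivity
      nlinarith
    have hup : ∀ u, h u ≤ 20 / 19 * q := by
      intro u; simp only [hh]; split_ifs
      · rw [div_le_iff₀ (hpos u)]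
        nlinarith [hcard u]
      · positivity
    have hone : ∀ u, h u ≤ 1 := by
      intro u
      by_cases hu : c ∈ Ψ u
      · have h1 : (1 : ℝ) ≤ ((Ψ u).card : ℝ) := by
          exact_mod_cast Finset.card_pos.2 ⟨c, hu⟩
        have := hΨ u
        have : q * 1 ≤ q * ((Ψ u).card : ℝ) := mul_le_mul_of_nonneg_left h1 hq
        linarith [hup u]
      · simp [hh, hu]
    have hcoin : ∀ u b, 0 ≤ coinWeight h u b := by
      rintro u (_ | _)
      · simpa [coinWeight] using hone u
      · simpa [coinWeight] using h0 u
    rw [trialWeight_insert hc hmul, ← prodExp_map, prodExp_prodMk]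
    refine le_trans (prodExp_le_prodExp hnn fun σ hσ => ?_) ih
    -- An outcome of the trial on `D` that uses `c` has weight zero.
    have hne : ∀ u, σ u ≠ some c := by
      intro u hu
      refine hσ u ?_
      simp [hu, trialWeight, hc]
    set θ : ℝ := 1 - Real.exp (-1) with hθ
    have hθ0 : 0 ≤ θ := by
      have := Real.exp_le_one_iff.2 (show (-1 : ℝ) ≤ 0 by norm_num)
      linarith
    set A : ℝ := ∑ d ∈ D, (θ * ρ d (idle σ) - if Q d (colorClass σ d) then 1 else 0) with hA
    set P : ℝ := prodExp (coinWeight h) fun β =>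
        if Q c ((idle σ).filter fun u => β u = true) then 1 else 0 with hP
    have hPρ : ρ c (idle σ) ≤ P := hρ c (idle σ) h hlow h0 hup hone
    calc prodExp (coinWeight h) (fun β => Real.exp (∑ d ∈ insert c D,
          (θ * ρ d (idle fun u => revealNext c (σ u, β u)) -
            if Q d (colorClass (fun u => revealNext c (σ u, β u)) d) then 1 else 0)))
        ≤ prodExp (coinWeight h) (fun β => Real.exp (A + θ * ρ c (idle σ)) * (1 + -θ *
            if Q c ((idle σ).filter fun u => β u = true) then 1 else 0)) := by
          refine prodExp_le_prodExp hcoin fun β _ => ?_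
          have hidle : (idle fun u => revealNext c (σ u, β u)) ⊆ idle σ := by
            intro u
            simp only [idle, Finset.mem_filter, Finset.mem_univ, true_and]
            rcases hs : σ u with _ | d <;> cases β u <;> simp [revealNext]
          have hclass : colorClass (fun u => revealNext c (σ u, β u)) c =
              (idle σ).filter fun u => β u = true := by
            ext u
            simp only [colorClass, idle, Finset.mem_filter, Finset.mem_univ, true_and]
            have := hne u
            rcases hs : σ u with _ | d <;> rcases hb : β u <;> simp_all [revealNext]
          have hclass' : ∀ d ∈ D, colorClass (fun u => revealNext c (σ u, β u)) d =
              colorClass σ d := by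
            intro d hd
            have hcd : c ≠ d := fun h => hc (h ▸ hd)
            ext u
            simp only [colorClass, Finset.mem_filter, Finset.mem_univ, true_and]
            rcases hs : σ u with _ | d <;> rcases hb : β u <;> simp_all [revealNext]
          rw [Finset.sum_insert hc, hclass]
          have hle : ∑ d ∈ D, (θ * ρ d (idle fun u => revealNext c (σ u, β u)) -
              if Q d (colorClass (fun u => revealNext c (σ u, β u)) d) then 1 else 0) ≤ A := by
            refine Finset.sum_le_sum fun d hd => ?_
            rw [hclass' d hd]
            have := mul_le_mul_of_nonneg_left (hmono d hidle) hθ0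
            linarith
          have hle' := mul_le_mul_of_nonneg_left (hmono c hidle) hθ0
          have hexp : (1 + -θ * if Q c ((idle σ).filter fun u => β u = true) then (1 : ℝ) else 0) =
              Real.exp (-if Q c ((idle σ).filter fun u => β u = true) then (1 : ℝ) else 0) := by
            split_ifs
            · rw [hθ]; ring_nf
            · simp
          rw [hexp, ← Real.exp_add]
          exact Real.exp_le_exp.2 (by linarith)
      _ = Real.exp (A + θ * ρ c (idle σ)) * (1 - θ * P) := by
          rw [prodExp_const_mul, prodExp_add, prodExp_one (sum_coinWeight h), prodExp_const_mul]
          ring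
      _ ≤ Real.exp (A + θ * ρ c (idle σ)) * Real.exp (-(θ * ρ c (idle σ))) := by
          refine mul_le_mul_of_nonneg_left ?_ (Real.exp_pos _).le
          have := Real.add_one_le_exp (-(θ * ρ c (idle σ)))
          have := mul_le_mul_of_nonneg_left hPρ hθ0
          linarith
      _ = Real.exp A := by rw [← Real.exp_add]; ring_nf

end Reveal

/-! ### Lower tail of the number of colors with a witness -/

section Witnesses

variable {V C : Type*} [Fintype V] [DecidableEq V] [Fintype C] [DecidableEq C]

theorem one_sub_sum_le_prod_one_sub {ι : Type*} (s : Finset ι) {f : ι → ℝ}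
    (h0 : ∀ i, 0 ≤ f i) (h1 : ∀ i, f i ≤ 1) : 1 - ∑ i ∈ s, f i ≤ ∏ i ∈ s, (1 - f i) := by
  classical
  induction s using Finset.induction_on with
  | empty => simp
  | insert a s ha ih =>
    rw [Finset.sum_insert ha, Finset.prod_insert ha]
    have hs : 0 ≤ ∑ i ∈ s, f i := Finset.sum_nonneg fun i _ => h0 i
    nlinarith [h0 a, mul_le_mul_of_nonneg_left ih (sub_nonneg.2 (h1 a)), mul_nonneg (h0 a) hs]

/-- The random set `T` of nodes of `R` whose coin shows `true` is likely to satisfy `T ∩ B M = M`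
for some `M ∈ 𝓜`. All sets `B M` contain a set `N` that contains every `M`, so the events
`T ∩ B M = M` are disjoint: each of them determines `M = T ∩ N`. -/
theorem sum_pow_card_le_prodExp {q : ℝ} (hq : 0 ≤ q) {h : V → ℝ} (h0 : ∀ u, 0 ≤ h u)
    (hup : ∀ u, h u ≤ 20 / 19 * q) (h1 : ∀ u, h u ≤ 1) {𝓜 : Finset (Finset V)}
    {B : Finset V → Finset V} {N : Finset V} (hN : ∀ M ∈ 𝓜, M ⊆ N) (hB : ∀ M ∈ 𝓜, N ⊆ B M)
    (hcard : ∀ M ∈ 𝓜, q * ((B M).card : ℝ) ≤ 3 / 20) (hlow : ∀ M ∈ 𝓜, ∀ u ∈ M, q ≤ h u)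
    (R : Finset V) :
    16 / 19 * ∑ M ∈ 𝓜 with M ⊆ R, q ^ M.card ≤ prodExp (coinWeight h) fun β =>
      if ∃ M ∈ 𝓜, (R.filter fun u => β u = true) ∩ B M = M then 1 else 0 := by
  have hcoin : ∀ u b, 0 ≤ coinWeight h u b := by
    rintro u (_ | _)
    · simpa [coinWeight] using h1 u
    · simpa [coinWeight] using h0 u
  -- The indicator that all nodes of `M` and no other nodes of `B M` show `true`, as a product over
  -- the nodes. For `M ⊆ R` this implies `T ∩ B M = M`.
  let f : Finset V → V → Bool → ℝ := fun M u b =>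
    if u ∈ M then (if b = true then 1 else 0)
    else if u ∈ B M then (if b = true then 0 else 1) else 1
  have hf : ∀ M (β : V → Bool), ∏ u, f M u (β u) =
      if ∀ u, (u ∈ M → β u = true) ∧ (u ∉ M → u ∈ B M → β u = false) then 1 else 0 := by
    intro M β
    split_ifs with hM
    · refine Finset.prod_eq_one fun u _ => ?_
      have := hM u
      simp only [f]
      split_ifs <;> simp_all
    · push Not at hM
      obtain ⟨u, hu⟩ := hM
      refine Finset.prod_eq_zero (Finset.mem_univ u) ?_
      simp only [f]
      by_cases huM : u ∈ M <;> simp_all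
  have hE : ∀ M ∈ 𝓜, 16 / 19 * q ^ M.card ≤ prodExp (coinWeight h) fun β => ∏ u, f M u (β u) := by
    intro M hM
    have hMB : M ⊆ B M := (hN M hM).trans (hB M hM)
    rw [prodExp_prod]
    have : ∀ u, ∑ b, coinWeight h u b * f M u b =
        if u ∈ M then h u else if u ∈ B M then 1 - h u else 1 := by
      intro u
      simp only [f, Fintype.sum_bool, coinWeight, if_true, Bool.false_eq_true, if_false]
      split_ifs <;> ring
    simp only [this]
    have hsplit : ∏ u, (if u ∈ M then h u else if u ∈ B M then 1 - h u else 1) =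
        (∏ u ∈ M, h u) * ∏ u ∈ B M \ M, (1 - h u) := by
      rw [Finset.prod_ite, Finset.prod_ite, Finset.prod_const_one, mul_one]
      congr 1
      · exact Finset.prod_congr (by ext; simp) fun _ _ => rfl
      · exact Finset.prod_congr (by ext; simp [and_comm]) fun _ _ => rfl
    rw [hsplit, mul_comm]
    refine mul_le_mul ?_ ?_ (by norm_num) (Finset.prod_nonneg fun u _ => h0 u)
    · rw [← Finset.prod_const]
      exact Finset.prod_le_prod (fun _ _ => hq) (hlow M hM)
    · refine le_trans ?_ (one_sub_sum_le_prod_one_sub _ h0 h1)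
      have : ∑ u ∈ B M \ M, h u ≤ ((B M).card : ℝ) * (20 / 19 * q) := by
        refine (Finset.sum_le_card_nsmul _ _ _ fun u _ => hup u).trans ?_
        rw [nsmul_eq_mul]
        refine mul_le_mul_of_nonneg_right ?_ (by positivity)
        exact_mod_cast Finset.card_le_card Finset.sdiff_subset
      linarith [hcard M hM]
  calc 16 / 19 * ∑ M ∈ 𝓜 with M ⊆ R, q ^ M.card
      ≤ ∑ M ∈ 𝓜 with M ⊆ R, prodExp (coinWeight h) fun β => ∏ u, f M u (β u) := by
        rw [Finset.mul_sum]
        exact Finset.sum_le_sum fun M hM => hE M (Finset.mem_filter.1 hM).1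
    _ = prodExp (coinWeight h) fun β => ∑ M ∈ 𝓜 with M ⊆ R, ∏ u, f M u (β u) :=
        (prodExp_sum _ _ _).symm
    _ ≤ _ := by
        refine prodExp_le_prodExp hcoin fun β _ => ?_
        simp only [hf]
        rw [Finset.sum_boole]
        have key : ∀ M ∈ (𝓜.filter (· ⊆ R)).filter (fun M =>
            ∀ u, (u ∈ M → β u = true) ∧ (u ∉ M → u ∈ B M → β u = false)),
            M ∈ 𝓜 ∧ (R.filter fun u => β u = true) ∩ B M = M ∧
              (R.filter fun u => β u = true) ∩ N = M := by
          intro M hM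
          simp only [Finset.mem_filter] at hM
          obtain ⟨⟨hM, hMR⟩, hβ⟩ := hM
          have hMB : (R.filter fun u => β u = true) ∩ B M = M := by
            ext u
            simp only [Finset.mem_inter, Finset.mem_filter]
            refine ⟨fun ⟨⟨_, hb⟩, hu⟩ => ?_, fun hu =>
              ⟨⟨hMR hu, (hβ u).1 hu⟩, hB M hM (hN M hM hu)⟩⟩
            by_contra huM
            simp [(hβ u).2 huM hu] at hb
          refine ⟨hM, hMB, Finset.Subset.antisymm ?_ ?_⟩
          · rw [← hMB]
            exact (Finset.inter_subset_inter_left (hB M hM)).trans (by rw [hMB])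
          · exact Finset.subset_inter (hMB ▸ Finset.inter_subset_left) (hN M hM)
        split_ifs with hex
        · have : ((𝓜.filter (· ⊆ R)).filter (fun M =>
            ∀ u, (u ∈ M → β u = true) ∧ (u ∉ M → u ∈ B M → β u = false))).card ≤ 1 :=
            Finset.card_le_one.2 fun M hM M' hM' => (key M hM).2.2.symm.trans (key M' hM').2.2
          exact_mod_cast this
        · have : ((𝓜.filter (· ⊆ R)).filter (fun M =>
            ∀ u, (u ∈ M → β u = true) ∧ (u ∉ M → u ∈ B M → β u = false))) = ∅ :=
            Finset.eq_empty_of_forall_notMem fun M hM => hex ⟨M, (key M hM).1, (key M hM).2.1⟩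
          simp [this]

/-- The number of colors `c` that have a witness `M ∈ 𝓜 c`, meaning that the class of `c` meets
`B M` exactly in `M`, is unlikely to be below a tenth of the quantity `L`, which is up to
constants its expectation. The supermartingale estimate `prodExp_exp_le_one` controls this number
in terms of the total weight of the witnesses that consist of idle nodes; that weight is `L` minus
a loss, which is a sum of independent contributions of the sampled nodes. -/
theorem prodExp_few_witnesses_le {Ψ : V → Finset C} {q : ℝ} (hq : 0 ≤ q)
    (hΨ : ∀ u, q * ((Ψ u).card : ℝ) = 1 / 20) {𝓜 : C → Finset (Finset V)}
    {B : Finset V → Finset V} {N : Finset V} (hN : ∀ c, ∀ M ∈ 𝓜 c, M ⊆ N)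
    (hB : ∀ c, ∀ M ∈ 𝓜 c, N ⊆ B M) (hcard : ∀ c, ∀ M ∈ 𝓜 c, q * ((B M).card : ℝ) ≤ 3 / 20)
    (hlist : ∀ c, ∀ M ∈ 𝓜 c, ∀ u ∈ M, c ∈ Ψ u) (htwo : ∀ c, ∀ M ∈ 𝓜 c, M.card ≤ 2)
    (hdeg : ∀ u, ∑ c, ∑ M ∈ 𝓜 c with u ∈ M, q ^ M.card ≤ 1) {L : ℝ}
    (hL : L = 16 / 19 * ∑ c, ∑ M ∈ 𝓜 c, q ^ M.card) :
    prodExp (trialWeight Ψ q Finset.univ) (fun σ =>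
      if ((Finset.univ.filter fun c => ∃ M ∈ 𝓜 c, colorClass σ c ∩ B M = M).card : ℝ) < L / 10
        then 1 else 0) ≤ 2 * Real.exp (-L / 5) := by
  have hL0 : 0 ≤ L := by rw [hL]; positivity
  set w := trialWeight Ψ q Finset.univ with hw
  have hnone : ∀ u, w u none = 19 / 20 := by
    intro u
    simp only [hw, trialWeight, Finset.univ_inter, hΨ]; norm_num
  have hnn : ∀ u o, 0 ≤ w u o := by
    rintro u (_ | d)
    · rw [hnone]; norm_num
    · simp only [hw, trialWeight]; split_ifs <;> simp [hq]
  have hsome : ∀ u, ∑ c, w u (some c) = 1 / 20 := by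
    intro u
    have := sum_trialWeight Ψ q Finset.univ u
    rw [Fintype.sum_option, ← hw, hnone] at this
    linarith
  set ρ : C → Finset V → ℝ := fun c R => 16 / 19 * ∑ M ∈ 𝓜 c with M ⊆ R, q ^ M.card with hρ
  set θ : ℝ := 1 - Real.exp (-1) with hθ
  have hθ6 : 3 / 5 ≤ θ := by
    have h1 : Real.exp (-1) ≤ 2 / 5 := by
      rw [Real.exp_neg, inv_le_comm₀ (Real.exp_pos _) (by norm_num)]
      linarith [Real.exp_one_gt_d9]
    linarith
  -- The weight of the witnesses that are lost if `u` joins the sample.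
  set d : V → ℝ := fun u => 16 / 19 * ∑ c, ∑ M ∈ 𝓜 c with u ∈ M, q ^ M.card with hd
  have hd0 : ∀ u, 0 ≤ d u := fun u => by simp only [hd]; positivity
  have hd1 : ∀ u, d u ≤ 1 := fun u => by simp only [hd]; linarith [hdeg u]
  -- Each witness has at most two elements.
  have hdsum : ∑ u, d u ≤ 2 * L := by
    simp only [hd]
    rw [← Finset.mul_sum, hL, Finset.sum_comm, mul_left_comm]
    refine mul_le_mul_of_nonneg_left ?_ (by norm_num)
    rw [Finset.mul_sum]
    refine Finset.sum_le_sum fun c _ => ?_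
    simp only [Finset.sum_filter]
    rw [Finset.sum_comm, Finset.mul_sum]
    refine Finset.sum_le_sum fun M hM => ?_
    rw [Finset.sum_ite_mem, Finset.univ_inter, Finset.sum_const, nsmul_eq_mul]
    exact mul_le_mul_of_nonneg_right (by exact_mod_cast htwo c M hM) (by positivity)
  let loss : (V → Option C) → ℝ := fun σ => ∑ u, if σ u = none then 0 else d u
  have hloss : prodExp w (fun σ => Real.exp (loss σ)) ≤ Real.exp (L / 5) := by
    simp only [loss, Real.exp_sum]
    rw [prodExp_prod w fun u o => Real.exp (if o = none then 0 else d u)]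
    calc ∏ u, ∑ o, w u o * Real.exp (if o = none then 0 else d u)
        ≤ ∏ u, Real.exp (d u / 10) := by
          refine Finset.prod_le_prod (fun u _ => Finset.sum_nonneg fun o _ =>
            mul_nonneg (hnn u o) (Real.exp_pos _).le) fun u _ => ?_
          rw [Fintype.sum_option]
          simp only [if_true, reduceCtorEq, if_false, Real.exp_zero]
          rw [← Finset.sum_mul, hsome, hnone]
          have h2 := Real.abs_exp_sub_one_le (x := d u) (by rw [abs_of_nonneg (hd0 u)]; exact hd1 u)
          rw [abs_of_nonneg (hd0 u)] at h2
          have h3 := le_of_abs_le h2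
          have h4 := Real.add_one_le_exp (d u / 10)
          linarith
      _ = Real.exp ((∑ u, d u) / 10) := by rw [← Real.exp_sum, Finset.sum_div]
      _ ≤ Real.exp (L / 5) := Real.exp_le_exp.2 (by linarith)
  have hidle : ∀ σ, L - loss σ ≤ ∑ c, ρ c (idle σ) := by
    intro σ
    have : L - ∑ c, ρ c (idle σ) = 16 / 19 * ∑ c, ∑ M ∈ 𝓜 c with ¬ M ⊆ idle σ, q ^ M.card := by
      simp only [hρ, ← Finset.mul_sum]
      rw [hL, ← mul_sub, ← Finset.sum_sub_distrib]
      congr 1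
      refine Finset.sum_congr rfl fun c _ => ?_
      rw [← Finset.sum_filter_add_sum_filter_not (𝓜 c) (· ⊆ idle σ)]
      ring
    have h2 : 16 / 19 * ∑ c, ∑ M ∈ 𝓜 c with ¬ M ⊆ idle σ, q ^ M.card ≤ loss σ := by
      have : loss σ = 16 / 19 * ∑ c, ∑ M ∈ 𝓜 c, ∑ u,
          if σ u = none then 0 else if u ∈ M then q ^ M.card else 0 := by
        simp only [loss, hd]
        have : ∀ u, (if σ u = none then (0 : ℝ)
            else 16 / 19 * ∑ c, ∑ M ∈ 𝓜 c with u ∈ M, q ^ M.card) = 16 / 19 * ∑ c, ∑ M ∈ 𝓜 c,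
            if σ u = none then 0 else if u ∈ M then q ^ M.card else 0 := by
          intro u
          split_ifs
          · simp
          · simp only [Finset.sum_filter]
        simp only [this]
        rw [← Finset.mul_sum, Finset.sum_comm]
        congr 1
        exact Finset.sum_congr rfl fun c _ => Finset.sum_comm
      rw [this]
      refine mul_le_mul_of_nonneg_left (Finset.sum_le_sum fun c _ => ?_) (by norm_num)
      rw [Finset.sum_filter]
      refine Finset.sum_le_sum fun M _ => ?_
      have hterm : ∀ u, 0 ≤ if σ u = none then (0 : ℝ) else if u ∈ M then q ^ M.card else 0 := by
        intro u; split_ifs <;> positivity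
      split_ifs with hM
      · exact Finset.sum_nonneg fun u _ => hterm u
      · obtain ⟨u, huM, hu⟩ := Finset.not_subset.1 (by simpa using hM)
        refine le_trans ?_ (Finset.single_le_sum (fun u _ => hterm u) (Finset.mem_univ u))
        simp only [idle, Finset.mem_filter, Finset.mem_univ, true_and] at hu
        simp [hu, huM]
    linarith
  have hmain := prodExp_exp_le_one hq (fun u => (hΨ u).le)
    (fun c T => ∃ M ∈ 𝓜 c, T ∩ B M = M) ρ
    (fun c R R' hR => by
      simp only [hρ]
      refine mul_le_mul_of_nonneg_left (Finset.sum_le_sum_of_subset_of_nonneg ?_ ?_) (by norm_num)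
      · exact Finset.monotone_filter_right _ fun M _ hM => hM.trans hR
      · intros; positivity)
    (fun c R h hlow h0 hup h1 => sum_pow_card_le_prodExp hq h0 hup h1 (hN c) (hB c) (hcard c)
      (fun M hM u hu => hlow u (hlist c M hM u hu)) R) Finset.univ
  rw [← hw, ← hθ] at hmain
  let E : (V → Option C) → ℝ := fun σ =>
    ∑ c, (θ * ρ c (idle σ) - if ∃ M ∈ 𝓜 c, colorClass σ c ∩ B M = M then 1 else 0)
  change prodExp w (fun σ => Real.exp (E σ)) ≤ 1 at hmain
  calc _ ≤ prodExp w (fun σ => Real.exp (-L / 2) * Real.exp (loss σ) +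
        Real.exp (L / 10 - θ * L / 2) * Real.exp (E σ)) := by
        -- Either the loss exceeds `L / 2`, or the weight of the idle witnesses is at least `L / 2`.
        refine prodExp_le_prodExp hnn fun σ _ => ?_
        split_ifs with hσ
        · rw [← Real.exp_add, ← Real.exp_add]
          by_cases hl : L / 2 ≤ loss σ
          · have : 1 ≤ Real.exp (-L / 2 + loss σ) := Real.one_le_exp (by linarith)
            linarith [Real.exp_pos (L / 10 - θ * L / 2 + E σ)]
          · have : 1 ≤ Real.exp (L / 10 - θ * L / 2 + E σ) := by
              refine Real.one_le_exp ?_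
              have hE : E σ = θ * ∑ c, ρ c (idle σ) -
                  ((Finset.univ.filter fun c => ∃ M ∈ 𝓜 c, colorClass σ c ∩ B M = M).card : ℝ) := by
                simp only [E, Finset.sum_sub_distrib, Finset.mul_sum, Finset.sum_boole]
              have h1 : L / 2 ≤ ∑ c, ρ c (idle σ) := by linarith [hidle σ]
              nlinarith
            linarith [Real.exp_pos (-L / 2 + loss σ)]
        · positivity
    _ ≤ Real.exp (-L / 2) * Real.exp (L / 5) + Real.exp (L / 10 - θ * L / 2) * 1 := by
        rw [prodExp_add, prodExp_const_mul, prodExp_const_mul]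
        gcongr
    _ ≤ 2 * Real.exp (-L / 5) := by
        rw [mul_one, ← Real.exp_add, two_mul]
        refine add_le_add (Real.exp_le_exp.2 (by linarith)) (Real.exp_le_exp.2 (by nlinarith))

end Witnesses

/-! ### The law of the random choices -/

section Law

variable {V : Type*} [Fintype V] [DecidableEq V] {U : ℕ}

/-- The color tried by a node: none if the node does not join the sample. -/
def drawn (p : Bool × Fin U) : Option (Fin U) := if p.1 = true then some p.2 else none

theorem nodeLaw_real_singleton (L : Finset (Fin U)) (hL : L.Nonempty) (p : Bool × Fin U) :
    (nodeLaw L hL).real {p} =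
      (if p.1 = true then 1 / 20 else 19 / 20) * if p.2 ∈ L then (L.card : ℝ)⁻¹ else 0 := by
  obtain ⟨b, c⟩ := p
  rw [nodeLaw, ← Set.singleton_prod_singleton, measureReal_prod_prod]
  congr 1
  · cases b <;> rw [bernoulliMeasure_real_apply _ (by measurability)] <;> norm_num
  · rw [Measure.real, PMF.toMeasure_apply_singleton _ _ (by measurability),
      PMF.uniformOfFinset_apply]
    split_ifs <;> simp

instance (L : Finset (Fin U)) (hL : L.Nonempty) : IsProbabilityMeasure (nodeLaw L hL) := by
  unfold nodeLaw; infer_instance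

instance (Ψ : V → Finset (Fin U)) (hΨ : ∀ v, (Ψ v).Nonempty) :
    IsProbabilityMeasure (choiceLaw Ψ hΨ) := by
  unfold choiceLaw; infer_instance

/-- The colors tried by the nodes are independent, with the weights `trialWeight`. -/
theorem choiceLaw_real_drawn {Ψ : V → Finset (Fin U)} (hΨ : ∀ v, (Ψ v).Nonempty) {k : ℕ}
    (hk : ∀ v, (Ψ v).card = k) (A : Set (V → Option (Fin U))) [DecidablePred (· ∈ A)] :
    (choiceLaw Ψ hΨ).real {ω | (fun v => drawn (ω v)) ∈ A} =
      prodExp (trialWeight Ψ (1 / (20 * k)) Finset.univ) fun σ => if σ ∈ A then 1 else 0 := by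
  classical
  have hw : trialWeight Ψ (1 / (20 * k)) Finset.univ = fun u o =>
      ∑ p with drawn p = o, (nodeLaw (Ψ u) (hΨ u)).real {p} := by
    funext u o
    have hk0 : (k : ℝ) ≠ 0 := by
      rw [← hk u]; exact_mod_cast (Finset.card_pos.2 (hΨ u)).ne'
    rw [Finset.sum_filter, Fintype.sum_prod_type]
    simp only [nodeLaw_real_singleton, drawn, Fintype.sum_bool]
    rcases o with _ | c
    · simp [trialWeight, hk]
      field_simp
      norm_num
    · simp [trialWeight, hk]
      split_ifs <;> ring
  rw [hw, ← prodExp_map]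
  have hfin : {ω : V → Bool × Fin U | (fun v => drawn (ω v)) ∈ A} =
      ((Finset.univ.filter fun ω : V → Bool × Fin U => (fun v => drawn (ω v)) ∈ A :
        Finset (V → Bool × Fin U)) : Set (V → Bool × Fin U)) := by
    ext; simp
  rw [hfin, ← sum_measureReal_singleton, Finset.sum_filter]
  refine Finset.sum_congr rfl fun ω _ => ?_
  rw [mul_ite, mul_one, mul_zero]
  congr 1
  rw [choiceLaw, Measure.real, Measure.pi_singleton, ENNReal.toReal_prod]
  rfl

end Law

/-! ### Slack from witnesses -/

section Slack

variable {V : Type*} [Fintype V] [DecidableEq V] (G : SimpleGraph V) [DecidableRel G.Adj] {U : ℕ}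

/-- The slack of a node is at least its list size minus its degree plus the number of colors that
are used by two of its neighbors, or by one if the color is not on its list. -/
theorem le_slack (Ψ : V → Finset (Fin U)) (col : V → Option (Fin U)) (v : V) (J : Finset (Fin U))
    (hin : ∀ c ∈ J, c ∈ Ψ v → 2 ≤ ((G.neighborFinset v).filter fun u => col u = some c).card)
    (hout : ∀ c ∈ J, c ∉ Ψ v → 1 ≤ ((G.neighborFinset v).filter fun u => col u = some c).card) :
    ((Ψ v).card : ℤ) - (G.degree v : ℤ) + (J.card : ℤ) ≤ slack G Ψ col v := by
  have hdeg : G.degree v = uncoloredDegree G col v +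
      ∑ c, ((G.neighborFinset v).filter fun u => col u = some c).card := by
    rw [← G.card_neighborFinset_eq_degree, Finset.card_eq_sum_card_fiberwise (f := col)
      (t := Finset.univ) (fun _ _ => Finset.mem_coe.2 (Finset.mem_univ _)), Fintype.sum_option]
    rfl
  have hpal : (Ψ v).card = (palette G Ψ col v).card +
      ((Ψ v).filter fun c => ¬ ∀ u ∈ G.neighborFinset v, col u ≠ some c).card :=
    (Finset.card_filter_add_card_filter_not _).symm
  have hJ : ((Ψ v).filter fun c => ¬ ∀ u ∈ G.neighborFinset v, col u ≠ some c).card + J.card ≤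
      ∑ c, ((G.neighborFinset v).filter fun u => col u = some c).card := by
    have h1 : ((Ψ v).filter fun c => ¬ ∀ u ∈ G.neighborFinset v, col u ≠ some c).card =
        ∑ c, if c ∈ Ψ v ∧ ¬ ∀ u ∈ G.neighborFinset v, col u ≠ some c then 1 else 0 := by
      rw [← Finset.card_filter]
      congr 1; ext; simp
    have h2 : J.card = ∑ c, if c ∈ J then 1 else 0 := by simp
    rw [h1, h2, ← Finset.sum_add_distrib]
    refine Finset.sum_le_sum fun c _ => ?_
    have h3 : (¬ ∀ u ∈ G.neighborFinset v, col u ≠ some c) →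
        1 ≤ ((G.neighborFinset v).filter fun u => col u = some c).card := by
      intro h
      push Not at h
      obtain ⟨u, hu, huc⟩ := h
      exact Finset.card_pos.2 ⟨u, Finset.mem_filter.2 ⟨hu, huc⟩⟩
    by_cases hcJ : c ∈ J
    · rw [if_pos hcJ]
      by_cases hcv : c ∈ Ψ v
      · have := hin c hcJ hcv
        split_ifs <;> omega
      · have := hout c hcJ hcv
        rw [if_neg fun h => hcv h.1]
        omega
    · rw [if_neg hcJ, add_zero]
      split_ifs with hn
      · exact h3 hn.2
      · exact Nat.zero_le _
  rw [slack]
  omega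

theorem slackGeneration_eq_some (ω : V → Bool × Fin U) (v : V) (c : Fin U)
    (hv : v ∈ colorClass (fun u => drawn (ω u)) c)
    (hN : ∀ u, G.Adj v u → u ∉ colorClass (fun u => drawn (ω u)) c) :
    slackGeneration G ω v = some c := by
  simp only [colorClass, drawn, Finset.mem_filter, Finset.mem_univ, true_and,
    Option.ite_none_right_eq_some, Option.some.injEq] at hv hN
  rw [slackGeneration, tryColors, if_pos, hv.2]
  refine ⟨by simpa using hv.1, fun u hu huv hc => hN u huv ⟨by simpa using hu, hc.trans hv.2⟩⟩

/-- The ordered pairs of distinct nonadjacent neighbors of `v`. -/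
def nonedges (v : V) : Finset (V × V) :=
  (G.neighborFinset v ×ˢ G.neighborFinset v).filter fun p => p.1 ≠ p.2 ∧ ¬ G.Adj p.1 p.2

/-- The sets of neighbors of `v` that add to the slack of `v` if they all get the color `c`: the
pairs of nonadjacent neighbors if `c` is on the list of `v`, and the single neighbors otherwise;
only neighbors with `c` on their lists are used. -/
def witnesses (Ψ : V → Finset (Fin U)) (v : V) (c : Fin U) : Finset (Finset V) :=
  if c ∈ Ψ v then
    ((nonedges G v).filter fun p => c ∈ Ψ p.1 ∧ c ∈ Ψ p.2).image fun p => {p.1, p.2}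
  else ((G.neighborFinset v).filter fun u => c ∈ Ψ u).image fun u => {u}

/-- The neighborhood of `v` together with the neighborhoods of the nodes of `M`. If `M` consists of
pairwise nonadjacent neighbors of `v`, and the nodes of this set that try some fixed color are
exactly those of `M`, then all nodes of `M` keep that color. -/
def surroundings (v : V) (M : Finset V) : Finset V :=
  G.neighborFinset v ∪ M.biUnion fun u => G.neighborFinset u

variable {G}

theorem witnesses_prop {Ψ : V → Finset (Fin U)} {v : V} {c : Fin U} {M : Finset V}
    (hM : M ∈ witnesses G Ψ v c) :
    M ⊆ G.neighborFinset v ∧ (∀ u ∈ M, c ∈ Ψ u) ∧ (∀ u ∈ M, ∀ y ∈ M, ¬ G.Adj u y) ∧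
      M.card = if c ∈ Ψ v then 2 else 1 := by
  unfold witnesses at hM
  split_ifs at hM with hc
  · obtain ⟨⟨a, b⟩, hp, rfl⟩ := Finset.mem_image.1 hM
    simp only [nonedges, Finset.mem_filter, Finset.mem_product] at hp
    obtain ⟨⟨⟨ha, hb⟩, hne, hab⟩, hca, hcb⟩ := hp
    have hba : ¬ G.Adj b a := fun h => hab h.symm
    refine ⟨?_, ?_, ?_, ?_⟩
    · intro u hu; simp only [Finset.mem_insert, Finset.mem_singleton] at hu
      rcases hu with rfl | rfl <;> assumption
    · intro u hu; simp only [Finset.mem_insert, Finset.mem_singleton] at hu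
      rcases hu with rfl | rfl <;> assumption
    · intro u hu y hy
      simp only [Finset.mem_insert, Finset.mem_singleton] at hu hy
      rcases hu with rfl | rfl <;> rcases hy with rfl | rfl <;> first | assumption | exact G.irrefl
    · rw [if_pos hc]; exact Finset.card_pair hne
  · obtain ⟨u, hu, rfl⟩ := Finset.mem_image.1 hM
    simp only [Finset.mem_filter] at hu
    refine ⟨by simpa using hu.1, by simpa using hu.2, by simp, by simp [hc]⟩

theorem card_surroundings_le {v : V} {M : Finset V} (hM : M.card ≤ 2) :
    (surroundings G v M).card ≤ 3 * G.maxDegree := by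
  have h1 : (M.biUnion fun u => G.neighborFinset u).card ≤ M.card * G.maxDegree :=
    Finset.card_biUnion_le_card_mul _ _ _ fun u _ => by
      rw [G.card_neighborFinset_eq_degree]; exact G.degree_le_maxDegree u
  have h2 := Finset.card_union_le (G.neighborFinset v) (M.biUnion fun u => G.neighborFinset u)
  have h3 := G.degree_le_maxDegree v
  have h4 := Nat.mul_le_mul_right G.maxDegree hM
  rw [G.card_neighborFinset_eq_degree] at h2
  unfold surroundings
  omega

theorem le_slack_slackGeneration {Ψ : V → Finset (Fin U)}
    (hΨ : ∀ v, (Ψ v).card = G.maxDegree + 1) (ω : V → Bool × Fin U) (v : V) :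
    (G.maxDegree : ℤ) + 1 - G.degree v + ((Finset.univ.filter fun c => ∃ M ∈ witnesses G Ψ v c,
      colorClass (fun u => drawn (ω u)) c ∩ surroundings G v M = M).card : ℤ) ≤
      slack G Ψ (slackGeneration G ω) v := by
  have key : ∀ c, (∃ M ∈ witnesses G Ψ v c,
      colorClass (fun u => drawn (ω u)) c ∩ surroundings G v M = M) →
      (if c ∈ Ψ v then 2 else 1) ≤
        ((G.neighborFinset v).filter fun u => slackGeneration G ω u = some c).card := by
    rintro c ⟨M, hM, hT⟩
    obtain ⟨hMN, -, hind, hcard⟩ := witnesses_prop hM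
    rw [← hcard]
    refine Finset.card_le_card fun u hu => Finset.mem_filter.2 ⟨hMN hu, ?_⟩
    refine slackGeneration_eq_some G ω u c ?_ fun y hy hyT => ?_
    · rw [← hT] at hu; exact (Finset.mem_inter.1 hu).1
    · refine hind u hu y ?_ hy
      rw [← hT]
      refine Finset.mem_inter.2 ⟨hyT, Finset.mem_union_right _ (Finset.mem_biUnion.2 ⟨u, hu, ?_⟩)⟩
      simpa using hy
  have := le_slack G Ψ (slackGeneration G ω) v (Finset.univ.filter fun c =>
    ∃ M ∈ witnesses G Ψ v c, colorClass (fun u => drawn (ω u)) c ∩ surroundings G v M = M)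
    (fun c hc hcv => by simpa [hcv] using key c (Finset.mem_filter.1 hc).2)
    (fun c hc hcv => by simpa [hcv] using key c (Finset.mem_filter.1 hc).2)
  rw [hΨ v] at this
  push_cast at this
  exact this

theorem sum_witnesses_mem_le_one {Ψ : V → Finset (Fin U)}
    (hΨ : ∀ v, (Ψ v).card = G.maxDegree + 1) {q : ℝ} (hq : q = 1 / (20 * (G.maxDegree + 1 : ℕ)))
    (v u : V) : ∑ c, ∑ M ∈ witnesses G Ψ v c with u ∈ M, q ^ M.card ≤ 1 := by
  have hΔ : (0 : ℝ) < (G.maxDegree + 1 : ℕ) := by positivity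
  have hq0 : 0 ≤ q := by rw [hq]; positivity
  have hqΔ : q * (G.maxDegree + 1 : ℕ) = 1 / 20 := by rw [hq]; field_simp
  have hc : ∀ c, ∑ M ∈ witnesses G Ψ v c with u ∈ M, q ^ M.card ≤ if c ∈ Ψ u then q else 0 := by
    intro c
    split_ifs with hcu
    · have hpow : ∀ M ∈ (witnesses G Ψ v c).filter (u ∈ ·),
          q ^ M.card = q ^ (if c ∈ Ψ v then 2 else 1) := by
        intro M hM
        rw [(witnesses_prop (Finset.mem_filter.1 hM).1).2.2.2]
      rw [Finset.sum_congr rfl hpow, Finset.sum_const, nsmul_eq_mul]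
      by_cases hcv : c ∈ Ψ v
      · have hsub : (witnesses G Ψ v c).filter (u ∈ ·) ⊆
            (G.neighborFinset v).image fun y => {u, y} := by
          intro M hM
          obtain ⟨hM, huM⟩ := Finset.mem_filter.1 hM
          rw [witnesses, if_pos hcv] at hM
          obtain ⟨⟨a, b⟩, hp, rfl⟩ := Finset.mem_image.1 hM
          simp only [nonedges, Finset.mem_filter, Finset.mem_product] at hp
          simp only [Finset.mem_insert, Finset.mem_singleton] at huM
          rcases huM with rfl | rfl
          · exact Finset.mem_image.2 ⟨b, hp.1.1.2, rfl⟩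
          · exact Finset.mem_image.2 ⟨a, hp.1.1.1, Finset.pair_comm _ _⟩
        have h1 := (Finset.card_le_card hsub).trans Finset.card_image_le
        rw [G.card_neighborFinset_eq_degree] at h1
        have h2 : (((witnesses G Ψ v c).filter (u ∈ ·)).card : ℝ) ≤ (G.maxDegree + 1 : ℕ) := by
          exact_mod_cast (h1.trans (G.degree_le_maxDegree v)).trans (Nat.le_succ _)
        rw [if_pos hcv]
        have := mul_le_mul_of_nonneg_right h2 (sq_nonneg q)
        nlinarith
      · have hsub : (witnesses G Ψ v c).filter (u ∈ ·) ⊆ {{u}} := by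
          intro M hM
          obtain ⟨hM, huM⟩ := Finset.mem_filter.1 hM
          rw [witnesses, if_neg hcv] at hM
          obtain ⟨a, hp, rfl⟩ := Finset.mem_image.1 hM
          rw [Finset.mem_singleton] at huM ⊢
          rw [huM]
        have h1 : (((witnesses G Ψ v c).filter (u ∈ ·)).card : ℝ) ≤ 1 := by
          exact_mod_cast Finset.card_le_card hsub
        rw [if_neg hcv, pow_one]
        nlinarith
    · refine (Finset.sum_eq_zero fun M hM => ?_).le
      obtain ⟨hM, huM⟩ := Finset.mem_filter.1 hM
      exact absurd ((witnesses_prop hM).2.1 u huM) hcu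
  refine (Finset.sum_le_sum fun c _ => hc c).trans ?_
  rw [Finset.sum_ite_mem, Finset.univ_inter, Finset.sum_const, nsmul_eq_mul, hΨ]
  linarith

/-- Neighbors whose lists differ much from the list of `v` make for many single witnesses; if there
are few such neighbors, most nonadjacent pairs of neighbors have many colors in common with `v`. -/
theorem card_nonedges_le_sum_witnesses {Ψ : V → Finset (Fin U)}
    (hΨ : ∀ v, (Ψ v).card = G.maxDegree + 1) {q : ℝ} (hq : q = 1 / (20 * (G.maxDegree + 1 : ℕ)))
    (v : V) : q / 40 * ((nonedges G v).card : ℝ) ≤ ∑ c, ∑ M ∈ witnesses G Ψ v c, q ^ M.card := by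
  have hΔ : (0 : ℝ) < (G.maxDegree + 1 : ℕ) := by positivity
  have hq0 : 0 ≤ q := by rw [hq]; positivity
  have hqΔ : q * (G.maxDegree + 1 : ℕ) = 1 / 20 := by rw [hq]; field_simp
  set N := G.neighborFinset v with hN
  set H := nonedges G v with hH
  let b : V → ℕ := fun u => (Ψ v \ Ψ u).card
  have hb : ∀ u, (Ψ u \ Ψ v).card = b u := fun u =>
    Finset.card_sdiff_comm (by rw [hΨ, hΨ])
  -- The single witnesses, counted once by colors and once by neighbors.
  have hsingle : ∑ c, (if c ∈ Ψ v then 0 else ((N.filter fun u => c ∈ Ψ u).card)) =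
      ∑ u ∈ N, b u := by
    have : ∀ c, (if c ∈ Ψ v then 0 else ((N.filter fun u => c ∈ Ψ u).card)) =
        ∑ u ∈ N, if c ∈ Ψ u \ Ψ v then 1 else 0 := by
      intro c
      split_ifs with hc
      · simp [hc]
      · rw [Finset.card_filter]; simp [hc]
    simp only [this]
    rw [Finset.sum_comm]
    refine Finset.sum_congr rfl fun u _ => ?_
    rw [← hb u, ← Finset.card_filter, Finset.filter_univ_mem]
  -- A pair of neighbors has all but `b p.1 + b p.2` colors of the list of `v` in common with `v`.
  have hpair : H.card * (G.maxDegree + 1) ≤ ∑ c, (if c ∈ Ψ v then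
      ((H.filter fun p => c ∈ Ψ p.1 ∧ c ∈ Ψ p.2).card) else 0) + ∑ p ∈ H, (b p.1 + b p.2) := by
    have : ∀ c, (if c ∈ Ψ v then ((H.filter fun p => c ∈ Ψ p.1 ∧ c ∈ Ψ p.2).card) else 0) =
        ∑ p ∈ H, if c ∈ Ψ v ∩ Ψ p.1 ∩ Ψ p.2 then 1 else 0 := by
      intro c
      split_ifs with hc
      · rw [Finset.card_filter]; simp [hc]
      · simp [hc]
    simp only [this]
    rw [Finset.sum_comm, ← Finset.sum_add_distrib, ← smul_eq_mul]
    refine Finset.card_nsmul_le_sum _ _ _ fun p _ => ?_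
    have h1 : (∑ c, if c ∈ Ψ v ∩ Ψ p.1 ∩ Ψ p.2 then 1 else 0) = (Ψ v ∩ Ψ p.1 ∩ Ψ p.2).card := by
      rw [← Finset.card_filter, Finset.filter_univ_mem]
    have h2 : Ψ v ⊆ (Ψ v ∩ Ψ p.1 ∩ Ψ p.2) ∪ ((Ψ v \ Ψ p.1) ∪ (Ψ v \ Ψ p.2)) := by
      intro c hc
      simp only [Finset.mem_union, Finset.mem_inter, Finset.mem_sdiff]
      tauto
    have h3 := Finset.card_le_card h2
    have h4 := Finset.card_union_le (Ψ v ∩ Ψ p.1 ∩ Ψ p.2) ((Ψ v \ Ψ p.1) ∪ (Ψ v \ Ψ p.2))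
    have h5 := Finset.card_union_le (Ψ v \ Ψ p.1) (Ψ v \ Ψ p.2)
    rw [hΨ] at h3
    rw [h1]
    simp only [b]
    omega
  have hNcard : N.card ≤ G.maxDegree := by
    rw [hN, G.card_neighborFinset_eq_degree]; exact G.degree_le_maxDegree v
  have hbsum : ∑ p ∈ H, (b p.1 + b p.2) ≤ 2 * (G.maxDegree * ∑ u ∈ N, b u) := by
    calc ∑ p ∈ H, (b p.1 + b p.2) ≤ ∑ p ∈ N ×ˢ N, (b p.1 + b p.2) :=
          Finset.sum_le_sum_of_subset (Finset.filter_subset _ _)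
      _ = 2 * (N.card * ∑ u ∈ N, b u) := by
          rw [Finset.sum_product]
          simp only [Finset.sum_add_distrib, Finset.sum_const, smul_eq_mul, ← Finset.mul_sum]
          ring
      _ ≤ _ := by gcongr
  have hwit : ∀ c, q ^ 2 / 2 * (if c ∈ Ψ v then
      ((H.filter fun p => c ∈ Ψ p.1 ∧ c ∈ Ψ p.2).card) else 0 : ℕ) +
      q * (if c ∈ Ψ v then 0 else ((N.filter fun u => c ∈ Ψ u).card) : ℕ) ≤
      ∑ M ∈ witnesses G Ψ v c, q ^ M.card := by
    intro c
    have hpow : ∀ M ∈ witnesses G Ψ v c, q ^ M.card = q ^ (if c ∈ Ψ v then 2 else 1) := by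
      intro M hM
      rw [(witnesses_prop hM).2.2.2]
    rw [Finset.sum_congr rfl hpow, Finset.sum_const, nsmul_eq_mul]
    by_cases hcv : c ∈ Ψ v
    · simp only [if_pos hcv]
      have h1 : (H.filter fun p => c ∈ Ψ p.1 ∧ c ∈ Ψ p.2).card ≤ 2 * (witnesses G Ψ v c).card := by
        rw [witnesses, if_pos hcv]
        -- An unordered pair comes from two ordered ones.
        refine Finset.card_le_mul_card_image _ _ fun M hM => ?_
        obtain ⟨⟨x, y⟩, -, rfl⟩ := Finset.mem_image.1 hM
        refine (Finset.card_le_card (t := {(x, y), (y, x)}) ?_).trans Finset.card_le_two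
        rintro ⟨s, t⟩ hst
        obtain ⟨hst, heq⟩ := Finset.mem_filter.1 hst
        have hne : s ≠ t := by
          have := (Finset.mem_filter.1 hst).1
          rw [hH, nonedges] at this
          exact (Finset.mem_filter.1 this).2.1
        have hs : s ∈ ({x, y} : Finset V) := by rw [← heq]; simp
        have ht : t ∈ ({x, y} : Finset V) := by rw [← heq]; simp
        simp only [Finset.mem_insert, Finset.mem_singleton, Prod.mk.injEq] at hs ht ⊢
        rcases hs with rfl | rfl <;> rcases ht with rfl | rfl <;> simp_all
      have h2 : ((H.filter fun p => c ∈ Ψ p.1 ∧ c ∈ Ψ p.2).card : ℝ) ≤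
          2 * ((witnesses G Ψ v c).card : ℝ) := by exact_mod_cast h1
      have := mul_le_mul_of_nonneg_right h2 (sq_nonneg q)
      push_cast
      linarith
    · simp only [if_neg hcv]
      rw [witnesses, if_neg hcv, Finset.card_image_of_injective _ Finset.singleton_injective]
      push_cast
      linarith
  refine le_trans ?_ (Finset.sum_le_sum fun c _ => hwit c)
  rw [Finset.sum_add_distrib, ← Finset.mul_sum, ← Finset.mul_sum, ← Nat.cast_sum, ← Nat.cast_sum,
    hsingle]
  set X := ∑ c, (if c ∈ Ψ v then ((H.filter fun p => c ∈ Ψ p.1 ∧ c ∈ Ψ p.2).card) else 0)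
  set Y := ∑ u ∈ N, b u
  clear_value X Y
  have h1 : (H.card : ℝ) * (G.maxDegree + 1 : ℕ) ≤ X + 2 * (G.maxDegree * Y) := by
    exact_mod_cast hpair.trans (Nat.add_le_add_left hbsum _)
  have h2 := mul_le_mul_of_nonneg_left h1 (by positivity : 0 ≤ q ^ 2 / 2)
  have h3 : q ^ 2 / 2 * ((H.card : ℝ) * (G.maxDegree + 1 : ℕ)) = q / 40 * H.card := by
    rw [show q ^ 2 / 2 * ((H.card : ℝ) * (G.maxDegree + 1 : ℕ)) =
      q * (G.maxDegree + 1 : ℕ) * (q / 2 * H.card) by ring, hqΔ]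
    ring
  have h4 : q * (G.maxDegree : ℝ) ≤ 1 := by
    push_cast at hqΔ; nlinarith
  have h5 : q * (q * (G.maxDegree : ℝ)) * Y ≤ q * 1 * Y := by gcongr
  rw [h3] at h2
  nlinarith

/-- A node with many pairs of nonadjacent neighbors gets slack with high probability. -/
theorem choiceLaw_slack_lt_le {Ψ : V → Finset (Fin U)} (hΨ : ∀ v, (Ψ v).card = G.maxDegree + 1)
    (v : V) {κ z : ℝ} (hκz : 0 ≤ κ * z)
    (hH : κ * z * (G.maxDegree : ℝ) ≤ ((nonedges G v).card : ℝ)) (hΔ : 0 < G.maxDegree) :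
    (choiceLaw Ψ (lists_nonempty G hΨ)).real
      {ω | (slack G Ψ (slackGeneration G ω) v : ℝ) < κ / 20000 * z} ≤
      2 * Real.exp (-(κ * z / 10000)) := by
  set q : ℝ := 1 / (20 * (G.maxDegree + 1 : ℕ)) with hq
  have hΔ' : (0 : ℝ) < (G.maxDegree + 1 : ℕ) := by positivity
  have hq0 : 0 ≤ q := by rw [hq]; positivity
  have hqΔ : q * (G.maxDegree + 1 : ℕ) = 1 / 20 := by rw [hq]; field_simp
  have htwo : ∀ c, ∀ M ∈ witnesses G Ψ v c, M.card ≤ 2 := by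
    intro c M hM
    rw [(witnesses_prop hM).2.2.2]; split_ifs <;> norm_num
  set L : ℝ := 16 / 19 * ∑ c, ∑ M ∈ witnesses G Ψ v c, q ^ M.card with hL
  have hLz : κ * z / 2000 ≤ L := by
    have h1 := card_nonedges_le_sum_witnesses hΨ hq v
    have h2 := mul_le_mul_of_nonneg_left hH (by positivity : 0 ≤ q / 40)
    have h3 : 1 / 40 ≤ q * (G.maxDegree : ℝ) := by
      have : (1 : ℝ) ≤ G.maxDegree := by exact_mod_cast hΔ
      push_cast at hqΔ
      nlinarith
    have h4 := mul_le_mul_of_nonneg_left h3 hκz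
    rw [hL]
    nlinarith
  have htail := prodExp_few_witnesses_le hq0 (fun u => by rw [hΨ u, hqΔ])
    (𝓜 := witnesses G Ψ v) (B := surroundings G v) (N := G.neighborFinset v)
    (fun c M hM => (witnesses_prop hM).1) (fun c M _ => Finset.subset_union_left)
    (fun c M hM => by
      have h1 : ((surroundings G v M).card : ℝ) ≤ 3 * (G.maxDegree + 1 : ℕ) := by
        have := card_surroundings_le (G := G) (v := v) (htwo c M hM)
        exact_mod_cast this.trans (by omega)
      have := mul_le_mul_of_nonneg_left h1 hq0
      linarith)
    (fun c M hM => (witnesses_prop hM).2.1) htwo (sum_witnesses_mem_le_one hΨ hq v) hL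
  have hlaw := choiceLaw_real_drawn (lists_nonempty G hΨ) hΨ
    {σ | ((Finset.univ.filter fun c => ∃ M ∈ witnesses G Ψ v c,
      colorClass σ c ∩ surroundings G v M = M).card : ℝ) < L / 10}
  simp only [Set.mem_ofPred_eq] at hlaw
  rw [← hq] at hlaw
  rw [← hlaw] at htail
  refine (measureReal_mono ?_).trans (htail.trans ?_)
  · intro ω hω
    simp only [Set.mem_ofPred_eq] at hω ⊢
    have h1 := le_slack_slackGeneration hΨ ω v
    have h2 : (G.degree v : ℤ) ≤ G.maxDegree := by exact_mod_cast G.degree_le_maxDegree v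
    have h3 : ((Finset.univ.filter fun c => ∃ M ∈ witnesses G Ψ v c,
      colorClass (fun u => drawn (ω u)) c ∩ surroundings G v M = M).card : ℤ) ≤
      slack G Ψ (slackGeneration G ω) v := by linarith
    have h4 : ((Finset.univ.filter fun c => ∃ M ∈ witnesses G Ψ v c,
      colorClass (fun u => drawn (ω u)) c ∩ surroundings G v M = M).card : ℝ) ≤
      slack G Ψ (slackGeneration G ω) v := by exact_mod_cast h3
    linarith
  · have := Real.exp_le_exp.2 (show -L / 5 ≤ -(κ * z / 10000) by linarith)
    linarith

end Slack

/-! ### Pairs of nonadjacent neighbors in almost-clique decompositions -/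

section Sparsity

variable {V : Type*} [Fintype V] [DecidableEq V] {G : SimpleGraph V} [DecidableRel G.Adj]

variable (G) in
/-- The neighbors of `v` other than `u` that are not adjacent to `u`. -/
def missing (v u : V) : Finset V :=
  (G.neighborFinset v).filter fun y => u ≠ y ∧ ¬ G.Adj u y

theorem card_nonedges (v : V) :
    (nonedges G v).card = ∑ u ∈ G.neighborFinset v, (missing G v u).card := by
  simp only [nonedges, missing, Finset.card_filter, Finset.sum_product]

theorem mul_card_le_card_nonedges {v : V} {D : Finset V} (hD : D ⊆ G.neighborFinset v) {r : ℝ}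
    (hr : ∀ u ∈ D, r ≤ ((missing G v u).card : ℝ)) :
    r * (D.card : ℝ) ≤ ((nonedges G v).card : ℝ) := by
  rw [card_nonedges]
  push_cast
  calc r * (D.card : ℝ) ≤ ∑ u ∈ D, ((missing G v u).card : ℝ) := by
        rw [mul_comm, ← nsmul_eq_mul]
        exact Finset.card_nsmul_le_sum _ _ _ hr
    _ ≤ _ := Finset.sum_le_sum_of_subset_of_nonneg hD fun _ _ _ => Nat.cast_nonneg _

theorem card_inter_add_card_missing {v u : V} (hu : u ∈ G.neighborFinset v) :
    (G.neighborFinset v ∩ G.neighborFinset u).card + (missing G v u).card + 1 = G.degree v := by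
  rw [← G.card_neighborFinset_eq_degree, ← Finset.card_erase_add_one hu]
  congr 1
  rw [← Finset.card_union_of_disjoint]
  · congr 1
    ext y
    simp only [missing, Finset.mem_union, Finset.mem_inter, Finset.mem_filter,
      SimpleGraph.mem_neighborFinset, Finset.mem_erase]
    have : G.Adj u y → y ≠ u := fun h => h.ne'
    constructor
    · rintro (⟨h1, h2⟩ | ⟨h1, h2, h3⟩)
      · exact ⟨this h2, h1⟩
      · exact ⟨h2.symm, h1⟩
    · rintro ⟨h1, h2⟩
      by_cases h : G.Adj u y
      · exact Or.inl ⟨h2, h⟩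
      · exact Or.inr ⟨h2, h1.symm, h⟩
  · rw [Finset.disjoint_left]
    intro y hy hy'
    simp only [missing, Finset.mem_inter, Finset.mem_filter,
      SimpleGraph.mem_neighborFinset] at hy hy'
    exact hy'.2.2 hy.2

/-- A node of almost full degree that is not dense has many pairs of nonadjacent neighbors. -/
theorem nonedges_of_not_isDense {η : ℝ} (hη : 0 < η) {v : V} (hv : ¬ IsDense G η v)
    (hd : (G.maxDegree : ℝ) + 1 - G.degree v ≤ η / 2 * G.maxDegree) :
    (η / 2 * G.maxDegree) * (η / 2 * G.maxDegree) ≤ ((nonedges G v).card : ℝ) := by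
  classical
  unfold IsDense at hv
  push Not at hv
  set D := (G.neighborFinset v).filter fun u => ¬ IsSimilar G η v u with hD
  have hfr : (Finset.univ.filter fun u => IsFriend G η v u) =
      (G.neighborFinset v).filter fun u => IsSimilar G η v u := by
    ext u; rw [Finset.mem_filter, Finset.mem_filter]; simp [IsFriend, and_comm]
  have hsplit : ((G.neighborFinset v).filter fun u => IsSimilar G η v u).card + D.card =
      G.degree v := by
    rw [hD, Finset.card_filter_add_card_filter_not, G.card_neighborFinset_eq_degree]
  have hfr' : ((Finset.univ.filter fun u => IsFriend G η v u).card : ℝ) + D.card = G.degree v := by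
    rw [hfr]; exact_mod_cast hsplit
  have hDcard : η / 2 * G.maxDegree ≤ (D.card : ℝ) := by
    have : ((Finset.univ.filter fun u => IsFriend G η v u).card : ℝ) <
      (1 - η) * (G.maxDegree : ℝ) := by convert hv
    linarith
  refine le_trans ?_ (mul_card_le_card_nonedges (D := D) (Finset.filter_subset _ _)
    (r := η / 2 * G.maxDegree) fun u hu => ?_)
  · exact mul_le_mul_of_nonneg_left hDcard (by positivity)
  · obtain ⟨huN, hus⟩ := Finset.mem_filter.1 hu
    unfold IsSimilar at hus
    push Not at hus
    have h1 := card_inter_add_card_missing huN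
    rw [Finset.inter_comm] at h1
    have h2 : ((G.neighborFinset u ∩ G.neighborFinset v).card : ℝ) + (missing G v u).card + 1 =
      G.degree v := by exact_mod_cast h1
    linarith

/-- If a node `w` of almost full degree has few pairs of nonadjacent neighbors, then most of its
neighbors are dense. -/
theorem exists_isDense_of_card_nonedges_lt {η τ : ℝ} (hτ : 3 * τ ≤ η)
    (hτΔ : 0 < τ * G.maxDegree) {w : V}
    (hd : (G.maxDegree : ℝ) + 1 - G.degree w < τ * G.maxDegree)
    (hH : ((nonedges G w).card : ℝ) < (τ * G.maxDegree) * (τ * G.maxDegree))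
    {D : Finset V} (hD : D ⊆ G.neighborFinset w) (hDcard : τ * G.maxDegree ≤ (D.card : ℝ)) :
    ∃ u ∈ D, IsDense G η u := by
  classical
  set x : ℝ := τ * G.maxDegree with hx
  have hηx : 3 * x ≤ η * G.maxDegree := by
    rw [hx, ← mul_assoc]; exact mul_le_mul_of_nonneg_right hτ (Nat.cast_nonneg _)
  set F := (G.neighborFinset w).filter fun u => x ≤ ((missing G w u).card : ℝ) with hF
  have hFcard : (F.card : ℝ) < x := by
    by_contra h
    push Not at h
    have := mul_card_le_card_nonedges (D := F) (Finset.filter_subset _ _) (r := x)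
      fun u hu => (Finset.mem_filter.1 hu).2
    nlinarith
  obtain ⟨u, huD, huF⟩ : ∃ u ∈ D, u ∉ F := by
    by_contra! h
    have h1 : (D.card : ℝ) ≤ F.card := by exact_mod_cast Finset.card_le_card h
    linarith
  have huN := hD huD
  have hgood : ∀ y ∈ G.neighborFinset w, y ∉ F → ((missing G w y).card : ℝ) < x := by
    intro y hy hyF
    by_contra h
    exact hyF (Finset.mem_filter.2 ⟨hy, not_lt.1 h⟩)
  have hu := hgood u huN huF
  refine ⟨u, huD, ?_⟩
  have hsub : ((G.neighborFinset w ∩ G.neighborFinset u) \ F) ⊆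
      Finset.univ.filter fun y => IsFriend G η u y := by
    intro y hy
    simp only [Finset.mem_sdiff, Finset.mem_inter] at hy
    obtain ⟨⟨hyN, hyu⟩, hyF⟩ := hy
    have hy := hgood y hyN hyF
    refine Finset.mem_filter.2 ⟨Finset.mem_univ _, ?_, by simpa using hyu⟩
    -- Counting `w` itself as a common neighbor of `u` and `y` saves an additive constant, so that
    -- `Δ` need not be large.
    have hcov : insert w (G.neighborFinset w) ⊆ (G.neighborFinset y ∩ G.neighborFinset u) ∪
        (insert u (missing G w u) ∪ insert y (missing G w y)) := by
      intro s hs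
      have hwu : G.Adj u w := by simpa [SimpleGraph.adj_comm] using huN
      have hwy : G.Adj y w := by simpa [SimpleGraph.adj_comm] using hyN
      simp only [Finset.mem_insert, Finset.mem_union, Finset.mem_inter, missing, Finset.mem_filter,
        SimpleGraph.mem_neighborFinset] at hs ⊢
      rcases hs with rfl | hs
      · exact Or.inl ⟨hwy, hwu⟩
      · by_cases h1 : G.Adj u s <;> by_cases h2 : G.Adj y s <;> by_cases h3 : s = u <;>
          by_cases h4 : s = y <;> simp_all [eq_comm]
    have h1 := Finset.card_le_card hcov
    have h2 := Finset.card_union_le (G.neighborFinset y ∩ G.neighborFinset u)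
      (insert u (missing G w u) ∪ insert y (missing G w y))
    have h3 := Finset.card_union_le (insert u (missing G w u)) (insert y (missing G w y))
    have h4 := Finset.card_insert_le u (missing G w u)
    have h5 := Finset.card_insert_le y (missing G w y)
    rw [Finset.card_insert_of_notMem (by simp), G.card_neighborFinset_eq_degree] at h1
    have h6 : G.degree w ≤ (G.neighborFinset y ∩ G.neighborFinset u).card +
      (missing G w u).card + (missing G w y).card + 1 := by omega
    have h7 : (G.degree w : ℝ) ≤ (G.neighborFinset y ∩ G.neighborFinset u).card +
      (missing G w u).card + (missing G w y).card + 1 := by exact_mod_cast h6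
    unfold IsSimilar
    linarith
  have h1 := Finset.card_le_card hsub
  have h2 := Finset.le_card_sdiff F (G.neighborFinset w ∩ G.neighborFinset u)
  have h3 := card_inter_add_card_missing huN
  have h4 : G.degree w ≤ (Finset.univ.filter fun y => IsFriend G η u y).card + F.card +
    (missing G w u).card + 1 := by omega
  have h5 : (G.degree w : ℝ) ≤ (Finset.univ.filter fun y => IsFriend G η u y).card + F.card +
    (missing G w u).card + 1 := by exact_mod_cast h4
  unfold IsDense
  have h6 : (1 - η) * (G.maxDegree : ℝ) ≤
      ((Finset.univ.filter fun y => IsFriend G η u y).card : ℝ) := by linarith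
  convert h6

/-- Edges that leave the neighborhood of `w` towards a set `A` of nodes that are not neighbors of
`w` are missing inside the neighborhood. -/
theorem sum_card_inter_le_card_nonedges (w : V) {A : Finset V}
    (hA : Disjoint A (G.neighborFinset w)) :
    ∑ x ∈ A, ((G.neighborFinset x ∩ G.neighborFinset w).card : ℝ) ≤
      (nonedges G w).card + G.degree w * ((G.maxDegree : ℝ) + 1 - G.degree w) := by
  have hdc : ∑ x ∈ A, (G.neighborFinset x ∩ G.neighborFinset w).card =
      ∑ u ∈ G.neighborFinset w, (G.neighborFinset u ∩ A).card := by
    have h1 : ∀ x, (G.neighborFinset x ∩ G.neighborFinset w).card =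
        ∑ u ∈ G.neighborFinset w, if G.Adj u x then 1 else 0 := by
      intro x
      rw [← Finset.card_filter]
      congr 1; ext u; simp [and_comm, G.adj_comm x u]
    have h2 : ∀ u, (G.neighborFinset u ∩ A).card = ∑ x ∈ A, if G.Adj u x then 1 else 0 := by
      intro u
      rw [← Finset.card_filter]
      congr 1; ext x; simp [and_comm]
    simp only [h1, h2]
    exact Finset.sum_comm
  have hterm : ∀ u ∈ G.neighborFinset w, (G.neighborFinset u ∩ A).card + G.degree w ≤
      (missing G w u).card + (G.maxDegree + 1) := by
    intro u hu
    have h1 := card_inter_add_card_missing hu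
    have h2 : (G.neighborFinset u ∩ A).card + (G.neighborFinset w ∩ G.neighborFinset u).card ≤
        G.degree u := by
      rw [← G.card_neighborFinset_eq_degree, ← Finset.card_union_of_disjoint]
      · exact Finset.card_le_card (Finset.union_subset Finset.inter_subset_left
          Finset.inter_subset_right)
      · exact Finset.disjoint_of_subset_left Finset.inter_subset_right
          (Finset.disjoint_of_subset_right Finset.inter_subset_left hA)
    have h3 := G.degree_le_maxDegree u
    omega
  have hsum := Finset.sum_le_sum hterm
  rw [Finset.sum_add_distrib, Finset.sum_add_distrib, ← hdc, ← card_nonedges] at hsum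
  simp only [Finset.sum_const, smul_eq_mul, G.card_neighborFinset_eq_degree] at hsum
  have : (∑ x ∈ A, ((G.neighborFinset x ∩ G.neighborFinset w).card : ℝ)) +
      G.degree w * G.degree w ≤ (nonedges G w).card + G.degree w * (G.maxDegree + 1) := by
    exact_mod_cast hsum
  linarith

variable {ε η : ℝ} {Vsparse : Finset V} {k : ℕ} {C : Fin k → Finset V}

theorem antidegree_add_card_inter (i : Fin k) (w : V) :
    antidegree G C i w + (G.neighborFinset w ∩ C i).card = (C i).card := by
  rw [antidegree, Finset.inter_comm, Finset.card_sdiff_add_card_inter]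

/-- An external neighbor of `w` has few neighbors in the almost-clique of `w`. -/
theorem IsACD.externalDegree_le_card_nonedges (h : IsACD G ε η Vsparse C) (hε : ε ≤ 1 / 3)
    {i : Fin k} {w : V} (hw : w ∈ C i) :
    (G.maxDegree : ℝ) / 3 * externalDegree G C i w ≤ (nonedges G w).card := by
  refine mul_card_le_card_nonedges Finset.inter_subset_left fun x hx => ?_
  obtain ⟨hxw, hx⟩ := Finset.mem_inter.1 hx
  obtain ⟨j, hj, hxj⟩ := Finset.mem_biUnion.1 hx
  have hji : j ≠ i := (Finset.mem_filter.1 hj).2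
  have hdis := h.disjoint_cliques j i hji
  have h1 : (G.neighborFinset x ∩ C j).card + (G.neighborFinset x ∩ C i).card ≤ G.maxDegree := by
    refine le_trans ?_ (G.degree_le_maxDegree x)
    rw [← G.card_neighborFinset_eq_degree, ← Finset.card_union_of_disjoint]
    · exact Finset.card_le_card (Finset.union_subset Finset.inter_subset_left
        Finset.inter_subset_left)
    · exact Finset.disjoint_of_subset_left Finset.inter_subset_right
        (Finset.disjoint_of_subset_right Finset.inter_subset_right hdis)
  have h2 : (G.neighborFinset w ∩ C i) ⊆ missing G w x ∪ (G.neighborFinset x ∩ C i) := by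
    intro y hy
    obtain ⟨hyw, hyi⟩ := Finset.mem_inter.1 hy
    by_cases hxy : G.Adj x y
    · exact Finset.mem_union_right _ (Finset.mem_inter.2 ⟨by simpa using hxy, hyi⟩)
    · refine Finset.mem_union_left _ (Finset.mem_filter.2 ⟨hyw, ?_, hxy⟩)
      rintro rfl
      exact Finset.disjoint_left.1 hdis hxj hyi
  have h3 := (Finset.card_le_card h2).trans (Finset.card_union_le _ _)
  have h4 := h.le_card_neighbors i w hw
  have h5 := h.le_card_neighbors j x hxj
  have h6 : ((G.neighborFinset x ∩ C j).card : ℝ) + (G.neighborFinset x ∩ C i).card ≤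
    G.maxDegree := by exact_mod_cast h1
  have h7 : ((G.neighborFinset w ∩ C i).card : ℝ) ≤ (missing G w x).card +
    (G.neighborFinset x ∩ C i).card := by exact_mod_cast h3
  have h8 : ε * G.maxDegree ≤ 1 / 3 * (G.maxDegree : ℝ) :=
    mul_le_mul_of_nonneg_right hε (Nat.cast_nonneg _)
  linarith

/-- If at most half of the almost-clique of `w` is not adjacent to `w`, then these nodes have many
neighbors among the neighbors of `w`. -/
theorem IsACD.antidegree_le_of_le_half (h : IsACD G ε η Vsparse C) (hε : ε ≤ 1 / 3)
    {i : Fin k} {w : V}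
    (ha : (antidegree G C i w : ℝ) ≤ (G.maxDegree : ℝ) / 2) :
    (G.maxDegree : ℝ) / 6 * antidegree G C i w ≤
      (nonedges G w).card + G.degree w * ((G.maxDegree : ℝ) + 1 - G.degree w) := by
  refine le_trans ?_ (sum_card_inter_le_card_nonedges w (A := C i \ G.neighborFinset w)
    Finset.sdiff_disjoint)
  rw [mul_comm, antidegree, ← nsmul_eq_mul]
  refine Finset.card_nsmul_le_sum _ _ _ fun x hx => ?_
  have hxi := (Finset.mem_sdiff.1 hx).1
  have h1 : G.neighborFinset x ∩ C i ⊆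
      (G.neighborFinset x ∩ G.neighborFinset w) ∪ (C i \ G.neighborFinset w) := by
    intro y hy
    simp only [Finset.mem_inter, Finset.mem_union, Finset.mem_sdiff] at hy ⊢
    tauto
  have h2 := (Finset.card_le_card h1).trans (Finset.card_union_le _ _)
  have h3 : ((G.neighborFinset x ∩ C i).card : ℝ) ≤
    (G.neighborFinset x ∩ G.neighborFinset w).card + antidegree G C i w := by exact_mod_cast h2
  have h4 := h.le_card_neighbors i x hxi
  have h8 : ε * G.maxDegree ≤ 1 / 3 * (G.maxDegree : ℝ) :=
    mul_le_mul_of_nonneg_right hε (Nat.cast_nonneg _)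
  linarith

theorem IsACD.degree_le (h : IsACD G ε η Vsparse C) (i : Fin k) (w : V) :
    G.degree w ≤ (G.neighborFinset w ∩ C i).card + externalDegree G C i w +
      (G.neighborFinset w ∩ Vsparse).card := by
  have h1 : G.neighborFinset w ⊆ (G.neighborFinset w ∩ C i) ∪
      (G.neighborFinset w ∩ (Finset.univ.filter fun j => j ≠ i).biUnion C) ∪
      (G.neighborFinset w ∩ Vsparse) := by
    intro y hy
    simp only [Finset.mem_union, Finset.mem_inter, Finset.mem_biUnion, Finset.mem_filter,
      Finset.mem_univ, true_and]
    rcases h.cover y with hs | ⟨j, hj⟩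
    · exact Or.inr ⟨hy, hs⟩
    · by_cases hji : j = i
      · exact Or.inl (Or.inl ⟨hy, hji ▸ hj⟩)
      · exact Or.inl (Or.inr ⟨hy, j, hji, hj⟩)
  have h2 := (Finset.card_le_card h1).trans (Finset.card_union_le _ _)
  have h3 := Finset.card_union_le (G.neighborFinset w ∩ C i)
    (G.neighborFinset w ∩ (Finset.univ.filter fun j => j ≠ i).biUnion C)
  rw [G.card_neighborFinset_eq_degree] at h2
  unfold externalDegree
  omega

/-- A node of an almost-clique has either a degree well below `Δ`, or many pairs of nonadjacent
neighbors. If more than half of the almost-clique is not adjacent to the node and neither of the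
two holds, then the node has many sparse neighbors, one of which would be dense. -/
theorem IsACD.degree_le_or_nonedges (h : IsACD G ε η Vsparse C) (hε : ε ≤ 1 / 3)
    (hη₀ : 0 < η) (hη : η ≤ 1 / 3) {i : Fin k} {w : V} (hw : w ∈ C i) :
    η ^ 2 / 144 * ((antidegree G C i w : ℝ) + externalDegree G C i w) ≤
        (G.maxDegree : ℝ) + 1 - G.degree w ∨
      η ^ 2 / 144 * ((antidegree G C i w : ℝ) + externalDegree G C i w) * G.maxDegree ≤
        (nonedges G w).card := by
  have hext := h.externalDegree_le_card_nonedges hε hw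
  have hanti := h.antidegree_le_of_le_half (i := i) (w := w) hε
  have hcard : (antidegree G C i w : ℝ) + (G.neighborFinset w ∩ C i).card = (C i).card := by
    exact_mod_cast antidegree_add_card_inter (G := G) i w
  have hdeg : (G.degree w : ℝ) ≤ (G.neighborFinset w ∩ C i).card + externalDegree G C i w +
      (G.neighborFinset w ∩ Vsparse).card := by exact_mod_cast h.degree_le i w
  have hCi := h.card_le i
  have hNi := h.le_card_neighbors i w hw
  have hdis : (G.neighborFinset w ∩ C i).card + externalDegree G C i w ≤ G.degree w := by
    rw [← G.card_neighborFinset_eq_degree, externalDegree, ← Finset.card_union_of_disjoint]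
    · exact Finset.card_le_card (Finset.union_subset Finset.inter_subset_left
        Finset.inter_subset_left)
    · refine Finset.disjoint_of_subset_left Finset.inter_subset_right
        (Finset.disjoint_of_subset_right Finset.inter_subset_right ?_)
      rw [Finset.disjoint_biUnion_right]
      exact fun j hj => h.disjoint_cliques i j (Finset.mem_filter.1 hj).2.symm
  have hdis' : ((G.neighborFinset w ∩ C i).card : ℝ) + externalDegree G C i w ≤ G.degree w := by
    exact_mod_cast hdis
  have hdΔ : (G.degree w : ℝ) ≤ G.maxDegree := by exact_mod_cast G.degree_le_maxDegree w
  have hlow := Finset.card_pos.2 ⟨w, hw⟩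
  set Δ : ℝ := (G.maxDegree : ℝ) with hΔ
  set a : ℝ := (antidegree G C i w : ℝ) with ha
  set e : ℝ := (externalDegree G C i w : ℝ) with he
  set m : ℝ := ((nonedges G w).card : ℝ) with hm
  have hΔ0 : 0 ≤ Δ := Nat.cast_nonneg _
  have ha0 : 0 ≤ a := Nat.cast_nonneg _
  have he0 : 0 ≤ e := Nat.cast_nonneg _
  have hεΔ : ε * Δ ≤ 1 / 3 * Δ := mul_le_mul_of_nonneg_right hε hΔ0
  have hκ : η ^ 2 / 144 ≤ 1 / 1296 := by nlinarith
  have hκ0 : 0 < η ^ 2 / 144 := by positivity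
  have hz : a + e ≤ Δ := by linarith
  -- The external neighbors alone suffice if there are at least `a` of them.
  by_cases hae : a ≤ e
  · refine Or.inr ?_
    have : (a + e) * Δ ≤ 2 * e * Δ := mul_le_mul_of_nonneg_right (by linarith) hΔ0
    have h0 : 0 ≤ (a + e) * Δ := by positivity
    have := mul_le_mul_of_nonneg_right hκ h0
    nlinarith
  push Not at hae
  by_cases hhalf : a ≤ Δ / 2
  · by_cases ht : a / 12 ≤ Δ + 1 - G.degree w
    · left
      have := mul_le_mul_of_nonneg_right hκ (by positivity : 0 ≤ a + e)
      linarith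
    · right
      push Not at ht
      have h1 := hanti hhalf
      have h2 : (G.degree w : ℝ) * (Δ + 1 - G.degree w) ≤ Δ * (a / 12) :=
        mul_le_mul hdΔ ht.le (by linarith) hΔ0
      have : (a + e) * Δ ≤ 2 * a * Δ := mul_le_mul_of_nonneg_right (by linarith) hΔ0
      have h0 : 0 ≤ (a + e) * Δ := by positivity
      have := mul_le_mul_of_nonneg_right hκ h0
      nlinarith
  push Not at hhalf
  have hΔpos : 0 < Δ := by
    have : (0 : ℝ) < (C i).card := by exact_mod_cast hlow
    by_contra hcon
    have h0 : Δ = 0 := le_antisymm (not_lt.1 hcon) hΔ0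
    rw [h0] at hCi
    linarith
  have hτ : 0 < η / 12 * Δ := by positivity
  have hηΔ : η * Δ ≤ 1 / 3 * Δ := mul_le_mul_of_nonneg_right hη hΔ0
  by_contra! hcon
  obtain ⟨hcon1, hcon2⟩ := hcon
  have hκz : η ^ 2 / 144 * (a + e) ≤ η ^ 2 / 144 * Δ := mul_le_mul_of_nonneg_left hz hκ0.le
  have hκΔ : η ^ 2 / 144 * Δ ≤ η / 12 * Δ := by
    refine mul_le_mul_of_nonneg_right ?_ hΔ0
    nlinarith
  have hm' : m < (η / 12 * Δ) * (η / 12 * Δ) := by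
    have := mul_le_mul_of_nonneg_right hκz hΔ0
    linarith
  -- At most `5Δ/6` neighbors of `w` lie in its almost-clique. As `deg w` is close to `Δ` and few
  -- neighbors are external, a positive fraction of the neighbors is sparse.
  have he18 : e < Δ / 18 := by
    by_contra hcon'
    push Not at hcon'
    have h1 : Δ / 3 * (Δ / 18) ≤ m := (mul_le_mul_of_nonneg_left hcon' (by positivity)).trans hext
    have h2 : (η / 12 * Δ) * (η / 12 * Δ) ≤ (Δ / 36) * (Δ / 36) := by
      apply mul_le_mul <;> linarith
    have h3 : 0 ≤ Δ * Δ := mul_nonneg hΔ0 hΔ0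
    linarith
  have hs : η / 12 * Δ ≤ ((G.neighborFinset w ∩ Vsparse).card : ℝ) := by linarith
  obtain ⟨u, hu, hdense⟩ := exists_isDense_of_card_nonedges_lt (η := η) (τ := η / 12) (by linarith)
    hτ (w := w) (by linarith) hm' (D := G.neighborFinset w ∩ Vsparse) Finset.inter_subset_left hs
  exact h.sparse_not_dense u (Finset.mem_inter.1 hu).2 hdense

end Sparsity

/-! ### The union bound -/

section Union

variable {V : Type*} [Fintype V] [DecidableEq V] {G : SimpleGraph V} [DecidableRel G.Adj] {U : ℕ}

/-- A node that has a degree well below `Δ` or many pairs of nonadjacent neighbors gets slack with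
high probability. In the former case its slack is large for every outcome. -/
theorem choiceLaw_slack_lt_le_of_or {Ψ : V → Finset (Fin U)}
    (hΨ : ∀ v, (Ψ v).card = G.maxDegree + 1) (v : V) {κ z : ℝ} (hκ : 0 < κ) (hz : 0 ≤ z)
    (h : κ * z ≤ (G.maxDegree : ℝ) + 1 - G.degree v ∨
      κ * z * G.maxDegree ≤ ((nonedges G v).card : ℝ)) (hΔ : 0 < G.maxDegree) :
    (choiceLaw Ψ (lists_nonempty G hΨ)).real
      {ω | (slack G Ψ (slackGeneration G ω) v : ℝ) < κ / 20000 * z} ≤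
      2 * Real.exp (-(κ * z / 10000)) := by
  rcases h with h | h
  · have : {ω | (slack G Ψ (slackGeneration G ω) v : ℝ) < κ / 20000 * z} = ∅ := by
      refine Set.eq_empty_of_forall_notMem fun ω hω => ?_
      rw [Set.mem_ofPred_eq] at hω
      have h1 := (le_add_of_nonneg_right (Int.natCast_nonneg _)).trans
        (le_slack_slackGeneration hΨ ω v)
      have h2 : (G.maxDegree : ℝ) + 1 - G.degree v ≤ slack G Ψ (slackGeneration G ω) v := by
        exact_mod_cast h1
      have h3 : 0 ≤ κ * z := by positivity
      linarith
    rw [this, measureReal_empty]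
    positivity
  · exact choiceLaw_slack_lt_le hΨ v (by positivity) h hΔ

/-- Union bound over the nodes `v`, for requirements of the form: `v` has slack at least a constant
multiple of `z v`. The requirement applies to the nodes of `A` only, for which `z v` is at least a
large multiple of `log n`. -/
theorem le_choiceLaw_forall_le_slack {Ψ : V → Finset (Fin U)}
    (hΨ : ∀ v, (Ψ v).card = G.maxDegree + 1) {κ K : ℝ} (hκ : 0 < κ) (A : Set V) (z : V → ℝ)
    (hz : ∀ v ∈ A, 0 ≤ z v)
    (hlog : ∀ v ∈ A, 10000 * (K + 2) / κ * Real.log (Fintype.card V) ≤ z v)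
    (h : ∀ v ∈ A, κ * z v ≤ (G.maxDegree : ℝ) + 1 - G.degree v ∨
      κ * z v * G.maxDegree ≤ ((nonedges G v).card : ℝ)) (hΔ : 0 < G.maxDegree) :
    1 - (Fintype.card V : ℝ) ^ (-K) ≤ (choiceLaw Ψ (lists_nonempty G hΨ)).real
      {ω | ∀ v ∈ A, κ / 20000 * z v ≤ slack G Ψ (slackGeneration G ω) v} := by
  classical
  set μ := choiceLaw Ψ (lists_nonempty G hΨ)
  have hn : (2 : ℝ) ≤ Fintype.card V := by
    have : Nonempty V := by
      by_contra hV
      rw [not_nonempty_iff] at hV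
      have : G.maxDegree ≤ 0 := G.maxDegree_le_of_forall_degree_le 0 fun v => hV.elim v
      omega
    have h1 : G.maxDegree < Fintype.card V := G.maxDegree_lt_card_verts
    exact_mod_cast (by omega : 2 ≤ Fintype.card V)
  set n : ℝ := (Fintype.card V : ℝ)
  have hbad : ∀ v, μ.real {ω | v ∈ A ∧ (slack G Ψ (slackGeneration G ω) v : ℝ) < κ / 20000 * z v}
      ≤ 2 * n ^ (-(K + 2)) := by
    intro v
    by_cases hv : v ∈ A
    · simp only [hv, true_and]
      refine (choiceLaw_slack_lt_le_of_or hΨ v hκ (hz v hv) (h v hv) hΔ).trans ?_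
      rw [Real.rpow_def_of_pos (by linarith)]
      have h1 := mul_le_mul_of_nonneg_left (hlog v hv) hκ.le
      have h2 : κ * (10000 * (K + 2) / κ * Real.log n) = 10000 * (K + 2) * Real.log n := by
        field_simp
      have h3 := Real.exp_le_exp.2 (show -(κ * z v / 10000) ≤ Real.log n * -(K + 2) by linarith)
      linarith
    · simp only [hv, false_and, Set.ofPred_false, measureReal_empty]
      positivity
  have hcompl : {ω | ∀ v ∈ A, κ / 20000 * z v ≤ slack G Ψ (slackGeneration G ω) v}ᶜ =
      ⋃ v, {ω | v ∈ A ∧ (slack G Ψ (slackGeneration G ω) v : ℝ) < κ / 20000 * z v} := by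
    ext ω; simp
  have hunion : μ.real {ω | ∀ v ∈ A, κ / 20000 * z v ≤ slack G Ψ (slackGeneration G ω) v}ᶜ ≤
      n ^ (-K) := by
    rw [hcompl]
    refine (measureReal_iUnion_fintype_le _).trans ((Finset.sum_le_sum fun v _ => hbad v).trans ?_)
    rw [Finset.sum_const, nsmul_eq_mul, Finset.card_univ]
    -- One factor `n` of the surplus pays for the sum over the nodes, the other for the factor `2`.
    have h1 : n ^ (-(K + 2)) = n ^ (-K) * (n ^ 2)⁻¹ := by
      rw [neg_add, Real.rpow_add (by linarith), Real.rpow_neg (by linarith) 2, Real.rpow_two]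
    have h2 : 0 < n ^ (-K) := Real.rpow_pos_of_pos (by linarith) _
    rw [h1, show n * (2 * (n ^ (-K) * (n ^ 2)⁻¹)) = n ^ (-K) * (2 / n) by field_simp]
    refine mul_le_of_le_one_right h2.le ?_
    rw [div_le_one (by linarith)]
    exact hn
  rw [probReal_compl_eq_one_sub (Set.toFinite _).measurableSet] at hunion
  linarith

end Union

end ListColoring

theorem mainTheorem5 (ε η : ℝ) (hε₀ : 0 < ε) (hε : ε ≤ 1 / 3) (hη₀ : 0 < η) (hη : η ≤ 1 / 3) :
    ∃ c₁ : ℝ, 0 < c₁ ∧ ∀ K : ℝ, 1 ≤ K → ∃ c : ℝ, 0 < c ∧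
      ∀ (V : Type*) [Fintype V] [DecidableEq V] (G : SimpleGraph V) [DecidableRel G.Adj]
        (U : ℕ) (Ψ : V → Finset (Fin U)) (hΨ : ∀ v, (Ψ v).card = G.maxDegree + 1)
        (Vsparse : Finset V) (k : ℕ) (C : Fin k → Finset V),
        ListColoring.IsACD G ε η Vsparse C →
        1 - (Fintype.card V : ℝ) ^ (-K) ≤
          (ListColoring.choiceLaw Ψ (ListColoring.lists_nonempty G hΨ)).real
            {ω | (c * Real.log (Fintype.card V) ≤ (G.maxDegree : ℝ) →
                    ∀ v ∈ Vsparse, c₁ * (G.maxDegree : ℝ) ≤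
                      (ListColoring.slack G Ψ (ListColoring.slackGeneration G ω) v : ℝ)) ∧
                 ∀ i, ∀ w ∈ C i,
                    c * Real.log (Fintype.card V) ≤
                      (ListColoring.antidegree G C i w : ℝ)
                        + (ListColoring.externalDegree G C i w : ℝ) →
                    c₁ * ((ListColoring.externalDegree G C i w : ℝ)
                        + (ListColoring.antidegree G C i w : ℝ)) ≤
                      (ListColoring.slack G Ψ (ListColoring.slackGeneration G ω) w : ℝ)} := by
  classical
  have hκ : 0 < η ^ 2 / 144 := by positivity
  refine ⟨η ^ 2 / 144 / 20000, by positivity, fun K hK =>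
    ⟨10000 * (K + 2) / (η ^ 2 / 144), by positivity, ?_⟩⟩
  intro V _ _ G _ U Ψ hΨ Vsparse k C hC
  set c : ℝ := 10000 * (K + 2) / (η ^ 2 / 144) with hc
  rcases Nat.eq_zero_or_pos G.maxDegree with hΔ | hΔ
  · -- Almost-cliques are empty, and the requirement on sparse nodes is that slack is nonnegative.
    have hCi : ∀ i, C i = ∅ := by
      intro i
      have h := hC.card_le i
      rw [hΔ, Nat.cast_zero, mul_zero] at h
      exact Finset.card_eq_zero.1 (by exact_mod_cast le_antisymm h (Nat.cast_nonneg _))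
    have huniv : ∀ ω v, (0 : ℝ) ≤
        (ListColoring.slack G Ψ (ListColoring.slackGeneration G ω) v : ℝ) := by
      intro ω v
      have h1 := (le_add_of_nonneg_right (Int.natCast_nonneg _)).trans
        (ListColoring.le_slack_slackGeneration hΨ ω v)
      have h2 := G.degree_le_maxDegree v
      exact_mod_cast (by omega : (0 : ℤ) ≤
        ListColoring.slack G Ψ (ListColoring.slackGeneration G ω) v)
    simp only [hΔ, hCi, Nat.cast_zero, mul_zero, huniv, implies_true, Finset.notMem_empty,
      IsEmpty.forall_iff, and_self, Set.ofPred_true, probReal_univ]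
    have : (0 : ℝ) ≤ (Fintype.card V : ℝ) ^ (-K) := Real.rpow_nonneg (Nat.cast_nonneg _) _
    linarith
  · -- A node lies in at most one almost-clique, and in none if it is sparse, so it is subject to
    -- one requirement only.
    let z : V → ℝ := fun v => if h : ∃ i, v ∈ C i then
      (ListColoring.antidegree G C h.choose v : ℝ) + ListColoring.externalDegree G C h.choose v
      else G.maxDegree
    have hzC : ∀ i, ∀ w ∈ C i, z w =
        (ListColoring.antidegree G C i w : ℝ) + ListColoring.externalDegree G C i w := by
      intro i w hw
      have hex : ∃ i, w ∈ C i := ⟨i, hw⟩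
      have hi : hex.choose = i := by
        by_contra hne
        exact Finset.disjoint_left.1 (hC.disjoint_cliques _ _ hne) hex.choose_spec hw
      simp only [z, dif_pos hex, hi]
    have hzS : ∀ v ∈ Vsparse, z v = G.maxDegree := by
      intro v hv
      have hex : ¬ ∃ i, v ∈ C i := fun ⟨i, hi⟩ =>
        Finset.disjoint_left.1 (hC.disjoint_sparse i) hv hi
      simp only [z, dif_neg hex]
    have hz : ∀ v, 0 ≤ z v := by
      intro v; simp only [z]; split_ifs <;> positivity
    refine (ListColoring.le_choiceLaw_forall_le_slack (K := K) hΨ hκ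
      {v | c * Real.log (Fintype.card V) ≤ z v} z (fun v _ => hz v) (fun v hv => hv)
      (fun v _ => ?_) hΔ).trans (measureReal_mono ?_)
    · rcases hC.cover v with hv | ⟨i, hi⟩
      · rw [hzS v hv]
        by_cases hd : (G.maxDegree : ℝ) + 1 - G.degree v ≤ η / 2 * G.maxDegree
        · right
          have h1 := ListColoring.nonedges_of_not_isDense hη₀ (hC.sparse_not_dense v hv) hd
          have h2 : 0 ≤ (η * G.maxDegree) * (η * G.maxDegree) := mul_self_nonneg _
          nlinarith
        · left
          have h1 : (0 : ℝ) ≤ G.maxDegree := Nat.cast_nonneg _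
          have h2 : η ^ 2 / 144 * (G.maxDegree : ℝ) ≤ η / 2 * G.maxDegree :=
            mul_le_mul_of_nonneg_right (by nlinarith) h1
          linarith
      · rw [hzC i v hi]
        exact hC.degree_le_or_nonedges hε hη₀ hη hi
    · intro ω hω
      refine ⟨fun hlog v hv => ?_, fun i w hw hlog => ?_⟩
      · have := hω v (by rw [Set.mem_ofPred_eq, hzS v hv]; exact hlog)
        rwa [hzS v hv] at this
      · have := hω w (by rw [Set.mem_ofPred_eq, hzC i w hw]; exact hlog)
        rwa [hzC i w hw, add_comm] at this
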